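/- Let $H_0,K_0$ be complex Hilbert spaces and let $\mathcal A\subseteq B(H_0)$, $\mathcal B\subseteq B(K_0)$ be $w^*$-closed algebras of operators containing the identity operators. Write $[\mathcal S]^{-w^*}$ for the $w^*$-closure of the linear span of $\mathcal S$ and $\Delta(\mathcal A)=\mathcal A\cap\mathcal A^*$. Assume that $\mathcal A$ and $\mathcal B$ are TRO equivalent, and let $\mathcal M\subseteq B(H_0,K_0)$ be a TRO (a linear subspace with $\mathcal M\mathcal M^*\mathcal M\subseteq\mathcal M$) implementing the equivalence, i.e. $\mathcal A=[\mathcal M^*\mathcal B\mathcal M]^{-w^*}$ and $\mathcal B=[\mathcal M\mathcal A\mathcal M^*]^{-w^*}$. Put $\mathcal U=[\mathcal B\mathcal M]^{-w^*}$ and $\mathcal V=[\mathcal M^*\mathcal B]^{-w^*}$; then $\mathcal V\mathcal U\subseteq\mathcal A$. Let ${}_{\mathcal A}\mathfrak M$ be the category whose objects are the normal representations $(H,\alpha)$ of $\mathcal A$ (a Hilbert space $H$ with a unital completely contractive $w^*$-continuous homomorphism $\alpha:\mathcal A\to B(H)$) and whose morphisms $(H_1,\alpha_1)\to(H_2,\alpha_2)$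 are the operators $T\in B(H_1,H_2)$ with $T\alpha_1(A)=\alpha_2(A)T$ for all $A\in\mathcal A$. Let ${}_{\mathcal A}\mathfrak{DM}$ be the category with the same objects in which this relation is required only for $A\in\Delta(\mathcal A)$; if $T$ is a morphism of ${}_{\mathcal A}\mathfrak{DM}$, so is its adjoint $T^*$. Define ${}_{\mathcal B}\mathfrak M$ and ${}_{\mathcal B}\mathfrak{DM}$ in the same way. For $(H,\alpha)\in{}_{\mathcal A}\mathfrak M$ put on the algebraic tensor product $\mathcal U\otimes H$ the seminorm $$\Big\|\sum_{j}T_j\otimes x_j\Big\|_{\mathcal F_{\mathcal U}(H)}=\sup\Big\{\Big\|\sum_{j}\alpha(ST_j)x_j\Big\|_{H^n}: n\in\mathbb N,\ S\in M_{n,1}(\mathcal V),\ \|S\|\le 1\Big\},$$ where $\alpha(ST)=(\alpha(S_1T),\dots,\alpha(S_nT))^t$ for $S=(S_1,\dots,S_n)^t$. Let $\mathcal F_{\mathcal U}(H)$ be the associated Hausdorff completion, and write $T\otimes x$ also for the image of $T\otimes x$ in it. Let $B\in\mathcal B$ act on $\mathcal F_{\mathcal U}(H)$ by $\beta(B)(T\otimes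 x)=BT\otimes x$, and for a morphism $F:H_1\to H_2$ of ${}_{\mathcal A}\mathfrak M$ let $\mathcal F_{\mathcal U}(F)(T\otimes x)=T\otimes F(x)$. Then: 1. Each $\mathcal F_{\mathcal U}(H)$ is a Hilbert space and $\beta$ is a normal representation of $\mathcal B$ on it, so that $\mathcal F_{\mathcal U}$ is a functor ${}_{\mathcal A}\mathfrak M\to{}_{\mathcal B}\mathfrak M$. 2. $\mathcal F_{\mathcal U}$ has a $\Delta$-extension: there is a functor $\mathcal G:{}_{\mathcal A}\mathfrak{DM}\to{}_{\mathcal B}\mathfrak{DM}$ whose composition with the inclusion ${}_{\mathcal A}\mathfrak M\hookrightarrow{}_{\mathcal A}\mathfrak{DM}$ equals the composition of $\mathcal F_{\mathcal U}$ with the inclusion ${}_{\mathcal B}\mathfrak M\hookrightarrow{}_{\mathcal B}\mathfrak{DM}$, and it can be chosen so that $\mathcal G(F)(M\otimes x)=M\otimes F(x)$ for all $M\in\mathcal M$, all $x\in H_1$ and all morphisms $F:H_1\to H_2$ of ${}_{\mathcal A}\mathfrak{DM}$. 3. This $\Delta$-extension $\mathcal G$ is a $*$-functor: $\mathcal G(F^*)=\mathcal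 G(F)^*$ for every morphism $F$ of ${}_{\mathcal A}\mathfrak{DM}$. -/

import Mathlib

open scoped TensorProduct InnerProductSpace Topology

universe u


noncomputable section

namespace DualOpAlg

/-! ### The weak* (σ-weak) topology of `B(E, F)` -/

section WeakStar

variable {E F G : Type*}
  [NormedAddCommGroup E] [InnerProductSpace ℂ E]
  [NormedAddCommGroup F] [InnerProductSpace ℂ F]
  [NormedAddCommGroup G] [InnerProductSpace ℂ G]

/-- Pairs of square summable sequences `(xₙ)` in `E` and `(yₙ)` in `F`. They index the
w*-continuous functionals `T ↦ ∑ ⟨yₙ, T xₙ⟩` of `B(E, F)`. -/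
def SqSummablePair (E F : Type*) [NormedAddCommGroup E] [NormedAddCommGroup F] : Type _ :=
  {p : (ℕ → E) × (ℕ → F) //
    Summable (fun n => ‖p.1 n‖ ^ 2) ∧ Summable (fun n => ‖p.2 n‖ ^ 2)}

theorem SqSummablePair.summable (p : SqSummablePair E F) (T : E →L[ℂ] F) :
    Summable (fun n => ⟪p.1.2 n, T (p.1.1 n)⟫_ℂ) := by
  refine Summable.of_norm_bounded (g := fun n => ‖T‖ * (‖p.1.1 n‖ ^ 2 + ‖p.1.2 n‖ ^ 2))
    ((p.2.1.add p.2.2).mul_left _) (fun n => ?_)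
  have h1 : ‖⟪p.1.2 n, T (p.1.1 n)⟫_ℂ‖ ≤ ‖p.1.2 n‖ * (‖T‖ * ‖p.1.1 n‖) :=
    (norm_inner_le_norm _ _).trans
      (mul_le_mul_of_nonneg_left (T.le_opNorm _) (norm_nonneg _))
  have h2 : ‖p.1.2 n‖ * ‖p.1.1 n‖ ≤ ‖p.1.1 n‖ ^ 2 + ‖p.1.2 n‖ ^ 2 := by
    nlinarith [sq_nonneg (‖p.1.1 n‖ - ‖p.1.2 n‖), sq_nonneg ‖p.1.1 n‖, sq_nonneg ‖p.1.2 n‖]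
  calc _ ≤ _ := h1
    _ = ‖T‖ * (‖p.1.2 n‖ * ‖p.1.1 n‖) := by ring
    _ ≤ _ := mul_le_mul_of_nonneg_left h2 (norm_nonneg _)

/-- The family of all functionals `T ↦ ∑ ⟨yₙ, T xₙ⟩`. -/
def wstarEval (E F : Type*) [NormedAddCommGroup E] [InnerProductSpace ℂ E]
    [NormedAddCommGroup F] [InnerProductSpace ℂ F] :
    (E →L[ℂ] F) →ₗ[ℂ] (SqSummablePair E F → ℂ) where
  toFun T p := ∑' n, ⟪p.1.2 n, T (p.1.1 n)⟫_ℂ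
  map_add' S T := by
    funext p
    simp only [add_apply, inner_add_right, Pi.add_apply]
    exact (p.summable S).tsum_add (p.summable T)
  map_smul' c T := by
    funext p
    simp only [smul_apply, inner_smul_right, Pi.smul_apply, smul_eq_mul,
      RingHom.id_apply]
    exact tsum_mul_left

/-- The weak* topology of `B(E, F)`: the coarsest topology that makes all functionals
`T ↦ ∑ ⟨yₙ, T xₙ⟩` with `(xₙ)`, `(yₙ)` square summable continuous. -/
abbrev wstarTopology (E F : Type*) [NormedAddCommGroup E] [InnerProductSpace ℂ E]
    [NormedAddCommGroup F] [InnerProductSpace ℂ F] : TopologicalSpace (E →L[ℂ] F) :=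
  TopologicalSpace.induced (wstarEval E F) inferInstance

/-- `[s]^{-w*}`: the w*-closure of the linear span of `s`. -/
def wstarSpan (s : Set (E →L[ℂ] F)) : Submodule ℂ (E →L[ℂ] F) :=
  letI : TopologicalSpace (E →L[ℂ] F) := wstarTopology E F
  haveI : ContinuousAdd (E →L[ℂ] F) := continuousAdd_induced (wstarEval E F)
  haveI : ContinuousSMul ℂ (E →L[ℂ] F) := continuousSMul_induced (wstarEval E F)
  (Submodule.span ℂ s).topologicalClosure

theorem subset_wstarSpan (s : Set (E →L[ℂ] F)) : s ⊆ wstarSpan s := fun _ hx =>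
  @subset_closure _ (wstarTopology E F) _ _ (Submodule.subset_span hx)

theorem isClosed_wstarSpan (s : Set (E →L[ℂ] F)) :
    IsClosed[wstarTopology E F] (wstarSpan s : Set (E →L[ℂ] F)) :=
  @isClosed_closure _ (wstarTopology E F) _

/-- A w*-continuous linear map which sends `s` into a w*-closed subspace `p` sends all of
`[s]^{-w*}` into `p`. -/
theorem map_mem_of_mem_wstarSpan {E' F' : Type*}
    [NormedAddCommGroup E'] [InnerProductSpace ℂ E']
    [NormedAddCommGroup F'] [InnerProductSpace ℂ F'] {s : Set (E →L[ℂ] F)}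
    {p : Submodule ℂ (E' →L[ℂ] F')} (hp : IsClosed[wstarTopology E' F'] (p : Set (E' →L[ℂ] F')))
    (f : (E →L[ℂ] F) →ₗ[ℂ] (E' →L[ℂ] F'))
    (hf : Continuous[wstarTopology E F, wstarTopology E' F'] f)
    (hs : ∀ x ∈ s, f x ∈ p) {x : E →L[ℂ] F} (hx : x ∈ wstarSpan s) : f x ∈ p := by
  let : TopologicalSpace (E →L[ℂ] F) := wstarTopology E F
  let : TopologicalSpace (E' →L[ℂ] F') := wstarTopology E' F'
  have h1 : IsClosed (f ⁻¹' (p : Set (E' →L[ℂ] F'))) := hp.preimage hf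
  have h2 : ((Submodule.span ℂ s : Submodule ℂ (E →L[ℂ] F)) : Set (E →L[ℂ] F)) ⊆
      f ⁻¹' (p : Set (E' →L[ℂ] F')) := by
    have : Submodule.span ℂ s ≤ p.comap f := Submodule.span_le.2 hs
    exact this
  exact closure_minimal h2 h1 hx

theorem summable_sq_map (T : E →L[ℂ] F) {x : ℕ → E} (hx : Summable (fun n => ‖x n‖ ^ 2)) :
    Summable (fun n => ‖T (x n)‖ ^ 2) := by
  refine Summable.of_nonneg_of_le (fun n => sq_nonneg _) (fun n => ?_) (hx.mul_left (‖T‖ ^ 2))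
  rw [← mul_pow]
  exact pow_le_pow_left₀ (norm_nonneg _) (T.le_opNorm _) 2

/-- `T ↦ T R` is w*-continuous. -/
theorem wstar_continuous_comp_right (R : E →L[ℂ] F) :
    Continuous[wstarTopology F G, wstarTopology E G]
      (fun T : F →L[ℂ] G => T ∘L R) := by
  let : TopologicalSpace (F →L[ℂ] G) := wstarTopology F G
  refine continuous_induced_rng.2 (continuous_pi fun p => ?_)
  let q : SqSummablePair F G := ⟨(fun n => R (p.1.1 n), p.1.2), summable_sq_map R p.2.1, p.2.2⟩
  exact (continuous_apply q).comp (continuous_induced_dom (f := wstarEval F G))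

/-- `T ↦ R T` is w*-continuous. -/
theorem wstar_continuous_comp_left [CompleteSpace F] [CompleteSpace G] (R : F →L[ℂ] G) :
    Continuous[wstarTopology E F, wstarTopology E G]
      (fun T : E →L[ℂ] F => R ∘L T) := by
  let : TopologicalSpace (E →L[ℂ] F) := wstarTopology E F
  refine continuous_induced_rng.2 (continuous_pi fun p => ?_)
  let q : SqSummablePair E F := ⟨(p.1.1, fun n => R.adjoint (p.1.2 n)), p.2.1,
    summable_sq_map R.adjoint p.2.2⟩
  have h := (continuous_apply q).comp (continuous_induced_dom (f := wstarEval E F))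
  refine h.congr fun T => ?_
  change ∑' n, ⟪R.adjoint (p.1.2 n), T (p.1.1 n)⟫_ℂ = ∑' n, ⟪p.1.2 n, R (T (p.1.1 n))⟫_ℂ
  simp only [ContinuousLinearMap.adjoint_inner_left]

end WeakStar

/-! ### Matrices of operators and completely contractive maps -/

section Matrices

variable {E F : Type*} [NormedAddCommGroup E] [NormedSpace ℂ E]
  [NormedAddCommGroup F] [NormedSpace ℂ F]

/-- The operator `E^n → F^m` (`ℓ²`-sums) given by an `m × n` matrix of operators. -/
def opMatrix {m n : ℕ} (X : Matrix (Fin m) (Fin n) (E →L[ℂ] F)) :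
    PiLp 2 (fun _ : Fin n => E) →L[ℂ] PiLp 2 (fun _ : Fin m => F) :=
  ((PiLp.continuousLinearEquiv 2 ℂ (fun _ : Fin m => F)).symm :
      (Fin m → F) →L[ℂ] PiLp 2 (fun _ : Fin m => F)) ∘L
    ContinuousLinearMap.pi (fun i => ∑ j, X i j ∘L PiLp.proj 2 (fun _ : Fin n => E) j)

theorem opMatrix_apply {m n : ℕ} (X : Matrix (Fin m) (Fin n) (E →L[ℂ] F))
    (v : PiLp 2 (fun _ : Fin n => E)) (i : Fin m) :
    opMatrix X v i = ∑ j, X i j (v j) := by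
  simp [opMatrix]

/-- The column operator `(S₁, …, Sₙ)ᵗ : E → F^n`, an element of `M_{n,1}(B(E, F))`. -/
def colOp {n : ℕ} (S : Fin n → E →L[ℂ] F) :
    PiLp 2 (fun _ : Fin 1 => E) →L[ℂ] PiLp 2 (fun _ : Fin n => F) :=
  opMatrix (Matrix.of fun i (_ : Fin 1) => S i)

/-- Complete contractivity of a representation of an algebra of operators. -/
def IsCompletelyContractive {E₀ : Type*} [NormedAddCommGroup E₀] [NormedSpace ℂ E₀]
    {A : Subalgebra ℂ (E₀ →L[ℂ] E₀)} (φ : A →ₐ[ℂ] (E →L[ℂ] E)) : Prop :=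
  ∀ (n : ℕ) (X : Matrix (Fin n) (Fin n) A),
    ‖opMatrix (X.map (fun a => φ a))‖ ≤ ‖opMatrix (X.map (fun a => (a : E₀ →L[ℂ] E₀)))‖

end Matrices

/-- w*-continuity of a representation; the algebra carries the relative w*-topology. -/
def IsWStarContinuous {E₀ E : Type*} [NormedAddCommGroup E₀] [InnerProductSpace ℂ E₀]
    [NormedAddCommGroup E] [InnerProductSpace ℂ E]
    {A : Subalgebra ℂ (E₀ →L[ℂ] E₀)} (φ : A →ₐ[ℂ] (E →L[ℂ] E)) : Prop :=
  Continuous[TopologicalSpace.induced Subtype.val (wstarTopology E₀ E₀), wstarTopology E E] φ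

/-! ### The categories of normal representations -/

section Categories

variable {H₀ : Type u} [NormedAddCommGroup H₀] [InnerProductSpace ℂ H₀] [CompleteSpace H₀]

/-- The diagonal `Δ(A) = A ∩ A*`. -/
def diagonal (A : Subalgebra ℂ (H₀ →L[ℂ] H₀)) : Set (H₀ →L[ℂ] H₀) :=
  {a | a ∈ A ∧ star a ∈ A}

/-- Normal representations of `A`: Hilbert spaces with a unital completely contractive
w*-continuous homomorphism into the bounded operators. -/
structure NormalRep (A : Subalgebra ℂ (H₀ →L[ℂ] H₀)) where
  carrier : Type u
  [normedAddCommGroup : NormedAddCommGroup carrier]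
  [innerProductSpace : InnerProductSpace ℂ carrier]
  [completeSpace : CompleteSpace carrier]
  rep : A →ₐ[ℂ] (carrier →L[ℂ] carrier)
  completelyContractive : IsCompletelyContractive rep
  wstarContinuous : IsWStarContinuous rep

attribute [instance] NormalRep.normedAddCommGroup NormalRep.innerProductSpace
  NormalRep.completeSpace

variable {A : Subalgebra ℂ (H₀ →L[ℂ] H₀)}

namespace NormalRep

/-- `Hom_A(X, Y)`: bounded operators intertwining the actions of `A`. -/
@[ext]
structure Hom (X Y : NormalRep A) where
  toCLM : X.carrier →L[ℂ] Y.carrier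
  comm : ∀ a : A, toCLM ∘L X.rep a = Y.rep a ∘L toCLM

/-- `Hom^D_A(X, Y)`: bounded operators intertwining the actions of `Δ(A)`. -/
@[ext]
structure DHom (X Y : NormalRep A) where
  toCLM : X.carrier →L[ℂ] Y.carrier
  comm : ∀ a : A, (a : H₀ →L[ℂ] H₀) ∈ diagonal A → toCLM ∘L X.rep a = Y.rep a ∘L toCLM

/-- The category `_A M` of normal representations and `A`-module maps. -/
instance : CategoryTheory.Category (NormalRep A) where
  Hom := Hom
  id X := ⟨ContinuousLinearMap.id ℂ _, fun _ => rfl⟩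
  comp f g := ⟨g.toCLM ∘L f.toCLM, fun a => by
    rw [ContinuousLinearMap.comp_assoc, f.comm, ← ContinuousLinearMap.comp_assoc, g.comm,
      ContinuousLinearMap.comp_assoc]⟩

/-- A completely contractive map is contractive. -/
theorem norm_rep_le (X : NormalRep A) (a : A) : ‖X.rep a‖ ≤ ‖(a : H₀ →L[ℂ] H₀)‖ := by
  have h := X.completelyContractive 1 (Matrix.of fun _ _ => a)
  have h1 : ‖opMatrix (Matrix.map (Matrix.of fun _ _ => a : Matrix (Fin 1) (Fin 1) A)
      (fun a => (a : H₀ →L[ℂ] H₀)))‖ ≤ ‖(a : H₀ →L[ℂ] H₀)‖ := by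
    refine ContinuousLinearMap.opNorm_le_bound _ (norm_nonneg _) fun v => ?_
    have e1 : ‖v‖ = ‖v 0‖ := by simp [PiLp.norm_eq_of_L2]
    rw [e1, PiLp.norm_eq_of_L2]
    simpa [opMatrix_apply] using ContinuousLinearMap.le_opNorm (a : H₀ →L[ℂ] H₀) (v 0)
  refine ContinuousLinearMap.opNorm_le_bound _ (norm_nonneg _) fun x => ?_
  have h2 := ((opMatrix (Matrix.map (Matrix.of fun _ _ => a : Matrix (Fin 1) (Fin 1) A)
      (fun a => X.rep a))).le_of_opNorm_le (h.trans h1)) (WithLp.toLp 2 fun _ => x)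
  simpa [PiLp.norm_eq_of_L2, opMatrix_apply] using h2

/-- A normal representation is a `*`-map on the diagonal; selfadjoint case. -/
theorem rep_isSelfAdjoint (X : NormalRep A) (a : A)
    (ha : IsSelfAdjoint (a : H₀ →L[ℂ] H₀)) : IsSelfAdjoint (X.rep a) := by
  have key : ∀ (t : ℝ) (x : X.carrier),
      -2 * t * (⟪x, X.rep a x⟫_ℂ).im ≤ t ^ 2 * (‖(a : H₀ →L[ℂ] H₀)‖ ^ 2 * ‖x‖ ^ 2) := by
    intro t x
    have h1 : ‖((1 + ((t : ℂ) * Complex.I) • a : A) : H₀ →L[ℂ] H₀)‖ ^ 2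
        ≤ 1 + t ^ 2 * ‖(a : H₀ →L[ℂ] H₀)‖ ^ 2 := by
      rw [sq, ← CStarRing.norm_star_mul_self]
      have e : star ((1 + ((t : ℂ) * Complex.I) • a : A) : H₀ →L[ℂ] H₀) *
          ((1 + ((t : ℂ) * Complex.I) • a : A) : H₀ →L[ℂ] H₀)
          = 1 + ((t : ℂ) ^ 2) • ((a : H₀ →L[ℂ] H₀) * a) := by
        push_cast
        simp only [star_add, star_one, star_smul, ha.star_eq, mul_add, add_mul, one_mul, mul_one,
          smul_mul_smul_comm]
        have : star ((t : ℂ) * Complex.I) = -((t : ℂ) * Complex.I) := by simp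
        rw [this]
        have : -((t : ℂ) * Complex.I) * ((t : ℂ) * Complex.I) = (t : ℂ) ^ 2 := by
          linear_combination (-(t : ℂ) ^ 2) * Complex.I_sq
        rw [this, neg_smul]
        abel
      rw [e]
      refine (norm_add_le _ _).trans ?_
      refine add_le_add ContinuousLinearMap.norm_id_le ?_
      rw [norm_smul]
      have : ‖(t : ℂ) ^ 2‖ = t ^ 2 := by simp
      rw [this, sq ‖_‖]
      exact mul_le_mul_of_nonneg_left (norm_mul_le _ _) (sq_nonneg _)
    have h2 : ‖x + ((t : ℂ) * Complex.I) • X.rep a x‖ ^ 2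
        ≤ (1 + t ^ 2 * ‖(a : H₀ →L[ℂ] H₀)‖ ^ 2) * ‖x‖ ^ 2 := by
      have h3 := (X.rep (1 + ((t : ℂ) * Complex.I) • a)).le_of_opNorm_le (X.norm_rep_le _) x
      have h4 : X.rep (1 + ((t : ℂ) * Complex.I) • a) x
          = x + ((t : ℂ) * Complex.I) • X.rep a x := by
        simp
      rw [h4] at h3
      calc _ ≤ _ := pow_le_pow_left₀ (norm_nonneg _) h3 2
        _ = _ := mul_pow _ _ _
        _ ≤ _ := mul_le_mul_of_nonneg_right h1 (sq_nonneg _)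
    rw [@norm_add_sq ℂ] at h2
    have h5 : RCLike.re ⟪x, ((t : ℂ) * Complex.I) • X.rep a x⟫_ℂ
        = - t * (⟪x, X.rep a x⟫_ℂ).im := by
      rw [inner_smul_right]
      simp
    rw [h5] at h2
    nlinarith [sq_nonneg ‖((t : ℂ) * Complex.I) • X.rep a x‖]
  rw [ContinuousLinearMap.isSelfAdjoint_iff_isSymmetric,
    LinearMap.isSymmetric_iff_inner_map_self_real]
  intro x
  have him : (⟪x, X.rep a x⟫_ℂ).im = 0 := by
    set c := (⟪x, X.rep a x⟫_ℂ).im with hc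
    set D := ‖(a : H₀ →L[ℂ] H₀)‖ ^ 2 * ‖x‖ ^ 2 with hD
    have hD0 : 0 ≤ D := by positivity
    have h := key (-c / (D + 1)) x
    rw [← hc, ← hD] at h
    have hpos : 0 < D + 1 := by linarith
    field_simp at h
    have : c ^ 2 ≤ 0 := by nlinarith [sq_nonneg c]
    exact pow_eq_zero_iff (two_ne_zero) |>.1 (le_antisymm this (sq_nonneg c))
  have h6 : (starRingEnd ℂ) ⟪x, X.rep a x⟫_ℂ = ⟪x, X.rep a x⟫_ℂ := Complex.conj_eq_iff_im.2 him
  rw [inner_conj_symm] at h6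
  change (starRingEnd ℂ) ⟪X.rep a x, x⟫_ℂ = ⟪X.rep a x, x⟫_ℂ
  rw [inner_conj_symm, h6]

/-- A normal representation restricts to a `*`-homomorphism on the diagonal. -/
theorem rep_star (X : NormalRep A) (a : A) (ha : star (a : H₀ →L[ℂ] H₀) ∈ A) :
    X.rep ⟨star (a : H₀ →L[ℂ] H₀), ha⟩ = star (X.rep a) := by
  set b : A := ⟨star (a : H₀ →L[ℂ] H₀), ha⟩ with hb
  have h1 := X.rep_isSelfAdjoint (a + b) (by
    simp [hb])
  have h2 := X.rep_isSelfAdjoint (Complex.I • (a - b)) (by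
    rw [isSelfAdjoint_iff]
    simp only [hb, SetLike.val_smul, AddSubgroupClass.coe_sub, star_smul, star_sub, star_star]
    simp [sub_eq_add_neg, add_comm])
  have e1 := h1.star_eq
  have e2 := h2.star_eq
  simp only [map_add, map_sub, map_smul, star_add, star_sub, star_smul] at e1 e2
  have e3 : star (X.rep a) - star (X.rep b) = -(X.rep a - X.rep b) := by
    have h3 := congrArg (fun z => Complex.I • z) e2
    have h4 : star Complex.I = -Complex.I := by simp
    simpa only [h4, neg_smul, smul_neg, smul_smul, Complex.I_mul_I, neg_neg, one_smul] using h3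
  have e4 : (2 : ℂ) • X.rep b = (2 : ℂ) • star (X.rep a) := by
    rw [two_smul, two_smul]
    have := congrArg₂ (· + ·) e1 e3
    rw [show star (X.rep a) + star (X.rep b) + (star (X.rep a) - star (X.rep b))
      = star (X.rep a) + star (X.rep a) by abel] at this
    rw [this]
    abel
  exact smul_right_injective _ (two_ne_zero) e4

/-- The adjoint of a `Δ(A)`-module map is a `Δ(A)`-module map. -/
def DHom.adjoint {X Y : NormalRep A} (f : DHom X Y) : DHom Y X where
  toCLM := ContinuousLinearMap.adjoint f.toCLM
  comm a ha := by
    have h := f.comm ⟨star (a : H₀ →L[ℂ] H₀), ha.2⟩ ⟨ha.2, by simp⟩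
    rw [X.rep_star a ha.2, Y.rep_star a ha.2] at h
    have h' := congrArg ContinuousLinearMap.adjoint h
    simp only [ContinuousLinearMap.adjoint_comp, ContinuousLinearMap.star_eq_adjoint,
      ContinuousLinearMap.adjoint_adjoint] at h'
    exact h'.symm

end NormalRep

/-- The objects of the category `_A DM`: they are the objects of `_A M`. -/
structure DNormalRep (A : Subalgebra ℂ (H₀ →L[ℂ] H₀)) where
  obj : NormalRep A

/-- The category `_A DM` of normal representations of `A` and `Δ(A)`-module maps. -/
instance : CategoryTheory.Category (DNormalRep A) where
  Hom X Y := NormalRep.DHom X.obj Y.obj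
  id X := ⟨ContinuousLinearMap.id ℂ _, fun _ _ => rfl⟩
  comp f g := ⟨g.toCLM ∘L f.toCLM, fun a ha => by
    rw [ContinuousLinearMap.comp_assoc, f.comm a ha, ← ContinuousLinearMap.comp_assoc,
      g.comm a ha, ContinuousLinearMap.comp_assoc]⟩

/-- The inclusion functor `_A M ↪ _A DM`. -/
def inclusion (A : Subalgebra ℂ (H₀ →L[ℂ] H₀)) :
    CategoryTheory.Functor (NormalRep A) (DNormalRep A) where
  obj X := ⟨X⟩
  map f := ⟨NormalRep.Hom.toCLM f, fun a _ => NormalRep.Hom.comm f a⟩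

variable {K₀ : Type u} [NormedAddCommGroup K₀] [InnerProductSpace ℂ K₀] [CompleteSpace K₀]
  {B : Subalgebra ℂ (K₀ →L[ℂ] K₀)}

/-- `G` is a Δ-extension of `F`: the square formed by `F`, `G` and the inclusions commutes. -/
def IsDeltaExtension (F : CategoryTheory.Functor (NormalRep A) (NormalRep B))
    (G : CategoryTheory.Functor (DNormalRep A) (DNormalRep B)) : Prop :=
  (inclusion A).comp G = F.comp (inclusion B)

theorem IsDeltaExtension.obj_eq {F : CategoryTheory.Functor (NormalRep A) (NormalRep B)}
    {G : CategoryTheory.Functor (DNormalRep A) (DNormalRep B)} (h : IsDeltaExtension F G)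
    (X : DNormalRep A) : G.obj X = ⟨F.obj X.obj⟩ :=
  CategoryTheory.Functor.congr_obj h X.obj

/-- If `G` is a Δ-extension of `F`, then `G(X) = F(X)` for all objects `X`; this is the operator
`G(f)`, regarded as an operator `F(X) → F(Y)` along these equalities. -/
def IsDeltaExtension.mapCLM {F : CategoryTheory.Functor (NormalRep A) (NormalRep B)}
    {G : CategoryTheory.Functor (DNormalRep A) (DNormalRep B)} (h : IsDeltaExtension F G)
    {X Y : DNormalRep A} (f : X ⟶ Y) : (F.obj X.obj).carrier →L[ℂ] (F.obj Y.obj).carrier :=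
  NormalRep.DHom.toCLM (CategoryTheory.CategoryStruct.comp
    (CategoryTheory.eqToHom (h.obj_eq X).symm)
    (CategoryTheory.CategoryStruct.comp (G.map f) (CategoryTheory.eqToHom (h.obj_eq Y))))

/-- `G` is a `*`-functor: `G(f*) = G(f)*` for all `Δ(A)`-module maps `f`. -/
def IsStarFunctor (G : CategoryTheory.Functor (DNormalRep A) (DNormalRep B)) : Prop :=
  ∀ (X Y : DNormalRep A) (f : X ⟶ Y),
    G.map (show Y ⟶ X from NormalRep.DHom.adjoint f) = NormalRep.DHom.adjoint (G.map f)

end Categories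

/-! ### TRO equivalence and the bimodules `U`, `V` -/

section TRO

variable {H₀ K₀ : Type u}
  [NormedAddCommGroup H₀] [InnerProductSpace ℂ H₀] [CompleteSpace H₀]
  [NormedAddCommGroup K₀] [InnerProductSpace ℂ K₀] [CompleteSpace K₀]

/-- A ternary ring of operators: a subspace `M` of `B(H₀, K₀)` with `M M* M ⊆ M`. -/
def IsTRO (M : Submodule ℂ (H₀ →L[ℂ] K₀)) : Prop :=
  ∀ a ∈ M, ∀ b ∈ M, ∀ c ∈ M, a ∘L ContinuousLinearMap.adjoint b ∘L c ∈ M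

/-- The TRO `M` implements a TRO equivalence of `A` and `B`:
`A = [M* B M]^{-w*}` and `B = [M A M*]^{-w*}`. In particular `A` and `B` are w*-closed. -/
structure IsTROEquivalence (A : Subalgebra ℂ (H₀ →L[ℂ] H₀)) (B : Subalgebra ℂ (K₀ →L[ℂ] K₀))
    (M : Submodule ℂ (H₀ →L[ℂ] K₀)) : Prop where
  isTRO : IsTRO M
  left_eq : Subalgebra.toSubmodule A =
    wstarSpan {T | ∃ m ∈ M, ∃ b ∈ B, ∃ n ∈ M, T = ContinuousLinearMap.adjoint m ∘L b ∘L n}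
  right_eq : Subalgebra.toSubmodule B =
    wstarSpan {T | ∃ m ∈ M, ∃ a ∈ A, ∃ n ∈ M, T = m ∘L a ∘L ContinuousLinearMap.adjoint n}

/-- `U = [B M]^{-w*} ⊆ B(H₀, K₀)`. -/
def bimodU (B : Subalgebra ℂ (K₀ →L[ℂ] K₀)) (M : Submodule ℂ (H₀ →L[ℂ] K₀)) :
    Submodule ℂ (H₀ →L[ℂ] K₀) :=
  wstarSpan {T | ∃ b ∈ B, ∃ m ∈ M, T = b ∘L m}

/-- `V = [M* B]^{-w*} ⊆ B(K₀, H₀)`. -/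
def bimodV (B : Subalgebra ℂ (K₀ →L[ℂ] K₀)) (M : Submodule ℂ (H₀ →L[ℂ] K₀)) :
    Submodule ℂ (K₀ →L[ℂ] H₀) :=
  wstarSpan {T | ∃ m ∈ M, ∃ b ∈ B, T = ContinuousLinearMap.adjoint m ∘L b}

variable {A : Subalgebra ℂ (H₀ →L[ℂ] H₀)} {B : Subalgebra ℂ (K₀ →L[ℂ] K₀)}
  {M : Submodule ℂ (H₀ →L[ℂ] K₀)}

/-- Composition on the left, as a linear map. -/
def compLeft {E F G : Type*} [NormedAddCommGroup E] [NormedSpace ℂ E]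
    [NormedAddCommGroup F] [NormedSpace ℂ F] [NormedAddCommGroup G] [NormedSpace ℂ G]
    (R : F →L[ℂ] G) : (E →L[ℂ] F) →ₗ[ℂ] (E →L[ℂ] G) where
  toFun T := R ∘L T
  map_add' S T := by ext; simp
  map_smul' c T := by ext; simp

/-- Composition on the right, as a linear map. -/
def compRight {E F G : Type*} [NormedAddCommGroup E] [NormedSpace ℂ E]
    [NormedAddCommGroup F] [NormedSpace ℂ F] [NormedAddCommGroup G] [NormedSpace ℂ G]
    (R : E →L[ℂ] F) : (F →L[ℂ] G) →ₗ[ℂ] (E →L[ℂ] G) where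
  toFun T := T ∘L R
  map_add' S T := by ext; simp
  map_smul' c T := by ext; simp

/-- `M ⊆ U`. -/
theorem mem_bimodU {m : H₀ →L[ℂ] K₀} (hm : m ∈ M) : m ∈ bimodU B M :=
  subset_wstarSpan _ ⟨1, B.one_mem, m, hm, rfl⟩

/-- `B U ⊆ U`. -/
theorem comp_mem_bimodU {b : K₀ →L[ℂ] K₀} (hb : b ∈ B) {T : H₀ →L[ℂ] K₀}
    (hT : T ∈ bimodU B M) : b ∘L T ∈ bimodU B M := by
  refine map_mem_of_mem_wstarSpan (isClosed_wstarSpan _) (compLeft b)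
    (wstar_continuous_comp_left b) ?_ hT
  rintro _ ⟨c, hc, m, hm, rfl⟩
  exact subset_wstarSpan _ ⟨b * c, B.mul_mem hb hc, m, hm, rfl⟩

/-- `V B ⊆ V`. -/
theorem comp_mem_bimodV {b : K₀ →L[ℂ] K₀} (hb : b ∈ B) {T : K₀ →L[ℂ] H₀}
    (hT : T ∈ bimodV B M) : T ∘L b ∈ bimodV B M := by
  refine map_mem_of_mem_wstarSpan (isClosed_wstarSpan _) (compRight b)
    (wstar_continuous_comp_right b) ?_ hT
  rintro _ ⟨m, hm, c, hc, rfl⟩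
  exact subset_wstarSpan _ ⟨m, hm, c * b, B.mul_mem hc hb, rfl⟩

/-- `V U ⊆ A`. -/
theorem IsTROEquivalence.comp_mem (h : IsTROEquivalence A B M) {S : K₀ →L[ℂ] H₀}
    (hS : S ∈ bimodV B M) {T : H₀ →L[ℂ] K₀} (hT : T ∈ bimodU B M) : S ∘L T ∈ A := by
  have hA : IsClosed[wstarTopology H₀ H₀]
      ((Subalgebra.toSubmodule A : Submodule ℂ (H₀ →L[ℂ] H₀)) : Set (H₀ →L[ℂ] H₀)) := by
    rw [h.left_eq]
    exact isClosed_wstarSpan _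
  have h1 : ∀ m ∈ M, ∀ b ∈ B, ∀ T ∈ bimodU B M,
      (ContinuousLinearMap.adjoint m ∘L b) ∘L T ∈ Subalgebra.toSubmodule A := by
    intro m hm b hb T hT
    refine map_mem_of_mem_wstarSpan hA (compLeft (ContinuousLinearMap.adjoint m ∘L b))
      (wstar_continuous_comp_left _) ?_ hT
    rintro _ ⟨c, hc, n, hn, rfl⟩
    rw [h.left_eq]
    exact subset_wstarSpan _ ⟨m, hm, b * c, B.mul_mem hb hc, n, hn, rfl⟩
  have h2 : S ∘L T ∈ Subalgebra.toSubmodule A := by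
    refine map_mem_of_mem_wstarSpan hA (compRight T) (wstar_continuous_comp_right T) ?_ hS
    rintro _ ⟨m, hm, b, hb, rfl⟩
    exact h1 m hm b hb T hT
  exact h2

/-! ### The seminorm on `U ⊗ H` and its completion -/

/-- The map `T ⊗ x ↦ α(S T) x = (α(S₁ T) x, …, α(Sₙ T) x)` from `U ⊗ H` to `H^n`, for a column
`S` with entries in `V`. -/
def colEval (h : IsTROEquivalence A B M) (X : NormalRep A) {n : ℕ} (S : Fin n → bimodV B M) :
    (bimodU B M) ⊗[ℂ] X.carrier →ₗ[ℂ] PiLp 2 (fun _ : Fin n => X.carrier) :=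
  TensorProduct.lift (LinearMap.mk₂ ℂ
    (fun (T : bimodU B M) (x : X.carrier) => WithLp.toLp 2 fun i =>
      X.rep ⟨(S i : K₀ →L[ℂ] H₀) ∘L (T : H₀ →L[ℂ] K₀), h.comp_mem (S i).2 T.2⟩ x)
    (fun T T' x => by
      ext i
      have : (⟨(S i : K₀ →L[ℂ] H₀) ∘L ((T + T' : bimodU B M) : H₀ →L[ℂ] K₀),
          h.comp_mem (S i).2 (T + T').2⟩ : A) =
          ⟨_, h.comp_mem (S i).2 T.2⟩ + ⟨_, h.comp_mem (S i).2 T'.2⟩ := by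
        ext; simp
      simp only [this, map_add, add_apply, PiLp.add_apply])
    (fun c T x => by
      ext i
      have : (⟨(S i : K₀ →L[ℂ] H₀) ∘L ((c • T : bimodU B M) : H₀ →L[ℂ] K₀),
          h.comp_mem (S i).2 (c • T).2⟩ : A) = c • ⟨_, h.comp_mem (S i).2 T.2⟩ := by
        ext; simp
      simp only [this, map_smul, smul_apply, PiLp.smul_apply])
    (fun T x y => by ext i; simp)
    (fun c T x => by ext i; simp))

theorem colEval_tmul (h : IsTROEquivalence A B M) (X : NormalRep A) {n : ℕ}
    (S : Fin n → bimodV B M) (T : bimodU B M) (x : X.carrier) (i : Fin n) :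
    colEval h X S (T ⊗ₜ x) i =
      X.rep ⟨(S i : K₀ →L[ℂ] H₀) ∘L (T : H₀ →L[ℂ] K₀), h.comp_mem (S i).2 T.2⟩ x := by
  simp [colEval]

/-- The union over `n` of the unit balls of `M_{n,1}(V)`. -/
def ColBall (B : Subalgebra ℂ (K₀ →L[ℂ] K₀)) (M : Submodule ℂ (H₀ →L[ℂ] K₀)) : Type u :=
  Σ n : ℕ, {S : Fin n → bimodV B M // ‖colOp (fun i => (S i : K₀ →L[ℂ] H₀))‖ ≤ 1}

instance : Nonempty (ColBall B M) :=
  ⟨⟨0, fun i => i.elim0, by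
    refine ContinuousLinearMap.opNorm_le_bound _ zero_le_one fun v => ?_
    have : ‖colOp (fun i : Fin 0 => ((i.elim0 : bimodV B M) : K₀ →L[ℂ] H₀)) v‖ = 0 := by
      simp [PiLp.norm_eq_of_L2]
    rw [this]
    positivity⟩⟩

/-- The supremum over `S` in the unit balls of `M_{n,1}(V)`, `n ∈ ℕ`, of
`‖∑ Tⱼ ⊗ xⱼ‖_S = ‖∑ α(S Tⱼ) xⱼ‖`. -/
def supNorm (h : IsTROEquivalence A B M) (X : NormalRep A)
    (z : (bimodU B M) ⊗[ℂ] X.carrier) : ℝ :=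
  ⨆ S : ColBall B M, ‖colEval h X S.2.1 z‖

theorem norm_colOp_apply {n : ℕ} (S : Fin n → K₀ →L[ℂ] H₀) (y : K₀) :
    ‖(WithLp.toLp 2 fun i => S i y : PiLp 2 fun _ : Fin n => H₀)‖ ≤ ‖colOp S‖ * ‖y‖ := by
  have h1 := (colOp S).le_opNorm (WithLp.toLp 2 fun _ => y)
  have h2 : colOp S (WithLp.toLp 2 fun _ => y) = WithLp.toLp 2 fun i => S i y := by
    ext i
    simp [colOp, opMatrix_apply]
  have h3 : ‖(WithLp.toLp 2 fun _ => y : PiLp 2 fun _ : Fin 1 => K₀)‖ = ‖y‖ := by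
    simp [PiLp.norm_eq_of_L2]
  rwa [h2, h3] at h1

theorem colEval_bound (h : IsTROEquivalence A B M) (X : NormalRep A) (S : ColBall B M)
    (T : bimodU B M) (x : X.carrier) :
    ‖colEval h X S.2.1 (T ⊗ₜ x)‖ ≤ ‖(T : H₀ →L[ℂ] K₀)‖ * ‖x‖ := by
  obtain ⟨n, S, hS⟩ := S
  change ‖colEval h X S (T ⊗ₜ x)‖ ≤ _
  rcases n with _ | n
  · have : ‖colEval h X S (T ⊗ₜ x)‖ = 0 := by simp [PiLp.norm_eq_of_L2]
    rw [this]
    positivity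
  · let Y : Matrix (Fin (n + 1)) (Fin (n + 1)) A := Matrix.of fun i j =>
      if j = 0 then ⟨(S i : K₀ →L[ℂ] H₀) ∘L (T : H₀ →L[ℂ] K₀), h.comp_mem (S i).2 T.2⟩ else 0
    have h1 : ‖opMatrix (Y.map (fun a => (a : H₀ →L[ℂ] H₀)))‖ ≤ ‖(T : H₀ →L[ℂ] K₀)‖ := by
      refine ContinuousLinearMap.opNorm_le_bound _ (norm_nonneg _) fun v => ?_
      have e : opMatrix (Y.map (fun a => (a : H₀ →L[ℂ] H₀))) v
          = WithLp.toLp 2 fun i => (S i : K₀ →L[ℂ] H₀) ((T : H₀ →L[ℂ] K₀) (v 0)) := by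
        ext i
        rw [opMatrix_apply, Finset.sum_eq_single 0]
        · simp [Y]
        · intro j _ hj
          simp [Y, hj]
        · simp
      rw [e]
      calc _ ≤ _ := norm_colOp_apply _ _
        _ ≤ 1 * (‖(T : H₀ →L[ℂ] K₀)‖ * ‖v‖) := by
          refine mul_le_mul hS ?_ (norm_nonneg _) zero_le_one
          exact (ContinuousLinearMap.le_opNorm _ _).trans
            (mul_le_mul_of_nonneg_left (PiLp.norm_apply_le v 0) (norm_nonneg _))
        _ = _ := one_mul _
    have h2 := (opMatrix (Y.map (fun a => X.rep a))).le_of_opNorm_le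
      ((X.completelyContractive _ Y).trans h1) (WithLp.toLp 2 (Pi.single 0 x))
    have e2 : opMatrix (Y.map (fun a => X.rep a)) (WithLp.toLp 2 (Pi.single 0 x))
        = colEval h X S (T ⊗ₜ x) := by
      ext i
      rw [opMatrix_apply, Finset.sum_eq_single 0, colEval_tmul]
      · simp [Y]
      · intro j _ hj
        simp [hj]
      · simp
    rw [e2] at h2
    simpa using h2

theorem supNorm_bddAbove (h : IsTROEquivalence A B M) (X : NormalRep A)
    (z : (bimodU B M) ⊗[ℂ] X.carrier) :
    BddAbove (Set.range fun S : ColBall B M => ‖colEval h X S.2.1 z‖) := by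
  induction z using TensorProduct.induction_on with
  | zero => exact ⟨0, by rintro _ ⟨S, rfl⟩; simp⟩
  | tmul T x => exact ⟨_, by rintro _ ⟨S, rfl⟩; exact colEval_bound h X S T x⟩
  | add z w hz hw =>
    obtain ⟨a, ha⟩ := hz
    obtain ⟨b, hb⟩ := hw
    refine ⟨a + b, ?_⟩
    rintro _ ⟨S, rfl⟩
    simp only [map_add]
    exact (norm_add_le _ _).trans (add_le_add (ha ⟨S, rfl⟩) (hb ⟨S, rfl⟩))

theorem le_supNorm (h : IsTROEquivalence A B M) (X : NormalRep A) (S : ColBall B M)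
    (z : (bimodU B M) ⊗[ℂ] X.carrier) : ‖colEval h X S.2.1 z‖ ≤ supNorm h X z :=
  le_ciSup (supNorm_bddAbove h X z) S

theorem supNorm_nonneg (h : IsTROEquivalence A B M) (X : NormalRep A)
    (z : (bimodU B M) ⊗[ℂ] X.carrier) : 0 ≤ supNorm h X z :=
  Real.iSup_nonneg fun _ => norm_nonneg _

/-- The supremum seminorm `‖·‖_{F_U(H)}` on `U ⊗ H`. -/
def supSeminorm (h : IsTROEquivalence A B M) (X : NormalRep A) :
    Seminorm ℂ ((bimodU B M) ⊗[ℂ] X.carrier) :=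
  Seminorm.of (supNorm h X)
    (fun z w => ciSup_le fun S => by
      rw [map_add]
      exact (norm_add_le _ _).trans (add_le_add (le_supNorm h X S z) (le_supNorm h X S w)))
    (fun c z => by
      simp only [supNorm, map_smul, norm_smul]
      exact (Real.mul_iSup_of_nonneg (norm_nonneg c) _).symm)

/-- The algebraic tensor product `U ⊗ H` with its supremum seminorm. -/
def PreFU (_h : IsTROEquivalence A B M) (X : NormalRep A) : Type u :=
  (bimodU B M) ⊗[ℂ] X.carrier

instance (h : IsTROEquivalence A B M) (X : NormalRep A) : SeminormedAddCommGroup (PreFU h X) :=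
  (supSeminorm h X).toAddGroupSeminorm.toSeminormedAddCommGroup

instance (h : IsTROEquivalence A B M) (X : NormalRep A) : Module ℂ (PreFU h X) :=
  inferInstanceAs (Module ℂ ((bimodU B M) ⊗[ℂ] X.carrier))

instance (h : IsTROEquivalence A B M) (X : NormalRep A) : NormedSpace ℂ (PreFU h X) where
  norm_smul_le c z := (map_smul_eq_mul (supSeminorm h X) c z).le

/-- The space `F_U(H)`: the (Hausdorff) completion of `U ⊗ H` for the supremum seminorm. -/
abbrev FUSpace (h : IsTROEquivalence A B M) (X : NormalRep A) : Type u :=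
  UniformSpace.Completion (PreFU h X)

/-- The image of `T ⊗ x` in `F_U(H)`. -/
def FUSpace.tmul (h : IsTROEquivalence A B M) (X : NormalRep A) (T : bimodU B M)
    (x : X.carrier) : FUSpace h X :=
  ((show PreFU h X from T ⊗ₜ[ℂ] x) : UniformSpace.Completion (PreFU h X))

theorem FUSpace.hom_ext {h : IsTROEquivalence A B M} {X : NormalRep A} {E : Type*}
    [NormedAddCommGroup E] [NormedSpace ℂ E] {f g : FUSpace h X →L[ℂ] E}
    (hfg : ∀ (T : bimodU B M) (x : X.carrier),
      f (FUSpace.tmul h X T x) = g (FUSpace.tmul h X T x)) : f = g := by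
  ext z
  induction z using UniformSpace.Completion.induction_on with
  | hp => exact isClosed_eq f.continuous g.continuous
  | ih z =>
    change (bimodU B M) ⊗[ℂ] X.carrier at z
    let ι : (bimodU B M) ⊗[ℂ] X.carrier →ₗ[ℂ] FUSpace h X :=
      (UniformSpace.Completion.toComplL (𝕜 := ℂ) (E := PreFU h X)).toLinearMap
    have : f.toLinearMap ∘ₗ ι = g.toLinearMap ∘ₗ ι := TensorProduct.ext' hfg
    exact LinearMap.congr_fun this z

theorem colEval_le (h : IsTROEquivalence A B M) (X : NormalRep A) {n : ℕ}
    (S : Fin n → bimodV B M) (z : (bimodU B M) ⊗[ℂ] X.carrier) :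
    ‖colEval h X S z‖ ≤ ‖colOp (fun i => (S i : K₀ →L[ℂ] H₀))‖ * supNorm h X z := by
  have hsm : ∀ c : ℂ, colEval h X (fun i => c • S i) z = c • colEval h X S z := by
    intro c
    have : colEval h X (fun i => c • S i) = c • colEval h X S := by
      refine TensorProduct.ext' fun T x => ?_
      ext i
      have e : (⟨((c • S i : bimodV B M) : K₀ →L[ℂ] H₀) ∘L (T : H₀ →L[ℂ] K₀),
          h.comp_mem (c • S i).2 T.2⟩ : A) = c • ⟨_, h.comp_mem (S i).2 T.2⟩ := by
        ext; simp
      simp only [LinearMap.smul_apply, PiLp.smul_apply, colEval_tmul, e, map_smul, smul_apply]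
    rw [this, LinearMap.smul_apply]
  have hcol : ∀ c : ℂ, colOp (fun i => ((c • S i : bimodV B M) : K₀ →L[ℂ] H₀))
      = c • colOp (fun i => (S i : K₀ →L[ℂ] H₀)) := by
    intro c
    ext v i
    simp [colOp, opMatrix_apply]
  set r := ‖colOp (fun i => (S i : K₀ →L[ℂ] H₀))‖ with hr
  rcases (norm_nonneg (colOp (fun i => (S i : K₀ →L[ℂ] H₀)))).eq_or_lt with h0 | hpos
  · have hle : ∀ k : ℕ, (k : ℝ) * ‖colEval h X S z‖ ≤ supNorm h X z := by
      intro k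
      have := le_supNorm h X ⟨n, fun i => (k : ℂ) • S i, by
        rw [hcol]
        refine (ContinuousLinearMap.opNorm_smul_le _ _).trans ?_
        rw [← h0, mul_zero]
        exact zero_le_one⟩ z
      simpa [hsm, norm_smul] using this
    rw [hr, ← h0, zero_mul]
    by_contra hcon
    push Not at hcon
    obtain ⟨k, hk⟩ := exists_nat_gt (supNorm h X z / ‖colEval h X S z‖)
    rw [div_lt_iff₀ hcon] at hk
    exact absurd (hle k) (not_le.2 hk)
  · have := le_supNorm h X ⟨n, fun i => ((r⁻¹ : ℝ) : ℂ) • S i, by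
      rw [hcol]
      refine (ContinuousLinearMap.opNorm_smul_le _ _).trans ?_
      rw [← hr, Complex.norm_real, Real.norm_of_nonneg (by positivity),
        inv_mul_cancel₀ hpos.ne']⟩ z
    have h1 : r⁻¹ * ‖colEval h X S z‖ ≤ supNorm h X z := by
      have e : ‖colEval h X (fun i => ((r⁻¹ : ℝ) : ℂ) • S i) z‖ = r⁻¹ * ‖colEval h X S z‖ := by
        rw [hsm, norm_smul, Complex.norm_real, Real.norm_of_nonneg (by positivity)]
      exact e ▸ this
    rwa [inv_mul_le_iff₀ hpos] at h1

/-! ### The action of `B` on `F_U(H)` and the functor `F_U` -/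

/-- `T ↦ b T` on `U`. -/
def mulU (b : B) : bimodU B M →ₗ[ℂ] bimodU B M :=
  (compLeft (b : K₀ →L[ℂ] K₀)).restrict fun _ hT => comp_mem_bimodU b.2 hT

/-- `T ⊗ x ↦ b T ⊗ x` on `U ⊗ H`. -/
def preAct (h : IsTROEquivalence A B M) (X : NormalRep A) (b : B) :
    PreFU h X →L[ℂ] PreFU h X :=
  LinearMap.mkContinuous
    (show (bimodU B M) ⊗[ℂ] X.carrier →ₗ[ℂ] (bimodU B M) ⊗[ℂ] X.carrier from
      (mulU b).rTensor X.carrier) ‖(b : K₀ →L[ℂ] K₀)‖ (fun z => by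
    change supNorm h X ((mulU b).rTensor X.carrier z) ≤ ‖(b : K₀ →L[ℂ] K₀)‖ * supNorm h X z
    refine ciSup_le fun S => ?_
    obtain ⟨n, S, hS⟩ := S
    change ‖colEval h X S ((mulU b).rTensor X.carrier z)‖ ≤ _
    let S' : Fin n → bimodV B M := fun i =>
      ⟨(S i : K₀ →L[ℂ] H₀) ∘L (b : K₀ →L[ℂ] K₀), comp_mem_bimodV b.2 (S i).2⟩
    have e : colEval h X S ∘ₗ (mulU b).rTensor X.carrier = colEval h X S' := by
      refine TensorProduct.ext' fun T x => ?_
      ext i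
      simp only [LinearMap.comp_apply, LinearMap.rTensor_tmul, colEval_tmul]
      rfl
    have e' : colEval h X S ((mulU b).rTensor X.carrier z) = colEval h X S' z :=
      LinearMap.congr_fun e z
    rw [e']
    refine (colEval_le h X S' z).trans
      (mul_le_mul_of_nonneg_right ?_ (supNorm_nonneg h X z))
    refine ContinuousLinearMap.opNorm_le_bound _ (norm_nonneg _) fun v => ?_
    have e2 : colOp (fun i => (S' i : K₀ →L[ℂ] H₀)) v
        = WithLp.toLp 2 fun i => (S i : K₀ →L[ℂ] H₀) ((b : K₀ →L[ℂ] K₀) (v 0)) := by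
      ext i
      simp [colOp, opMatrix_apply, S']
    rw [e2]
    calc _ ≤ _ := norm_colOp_apply _ _
      _ ≤ 1 * (‖(b : K₀ →L[ℂ] K₀)‖ * ‖v‖) := by
        refine mul_le_mul hS ?_ (norm_nonneg _) zero_le_one
        exact (ContinuousLinearMap.le_opNorm _ _).trans
          (mul_le_mul_of_nonneg_left (PiLp.norm_apply_le v 0) (norm_nonneg _))
      _ = _ := one_mul _)

/-- The operator `β(b)` on `F_U(H)`, the extension of `T ⊗ x ↦ b T ⊗ x`. -/
def actCLM (h : IsTROEquivalence A B M) (X : NormalRep A) (b : B) :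
    FUSpace h X →L[ℂ] FUSpace h X :=
  (preAct h X b).completion

theorem actCLM_tmul (h : IsTROEquivalence A B M) (X : NormalRep A) (b : B)
    (T : bimodU B M) (x : X.carrier) :
    actCLM h X b (FUSpace.tmul h X T x) = FUSpace.tmul h X (mulU b T) x :=
  ContinuousLinearMap.completion_apply_coe _ _

theorem FUSpace.tmul_add_left (h : IsTROEquivalence A B M) (X : NormalRep A)
    (T T' : bimodU B M) (x : X.carrier) :
    FUSpace.tmul h X (T + T') x = FUSpace.tmul h X T x + FUSpace.tmul h X T' x := by
  have := TensorProduct.add_tmul (R := ℂ) T T' x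
  have h2 := congrArg (fun z : (bimodU B M) ⊗[ℂ] X.carrier =>
    UniformSpace.Completion.toComplL (𝕜 := ℂ) (E := PreFU h X) z) this
  exact h2.trans (map_add (UniformSpace.Completion.toComplL (𝕜 := ℂ) (E := PreFU h X)) _ _)

theorem FUSpace.tmul_smul_left (h : IsTROEquivalence A B M) (X : NormalRep A)
    (c : ℂ) (T : bimodU B M) (x : X.carrier) :
    FUSpace.tmul h X (c • T) x = c • FUSpace.tmul h X T x := by
  have := TensorProduct.smul_tmul' (R := ℂ) c T x
  have h2 := congrArg (fun z : (bimodU B M) ⊗[ℂ] X.carrier =>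
    UniformSpace.Completion.toComplL (𝕜 := ℂ) (E := PreFU h X) z) this.symm
  exact h2.trans (map_smul (UniformSpace.Completion.toComplL (𝕜 := ℂ) (E := PreFU h X)) _ _)

/-- The representation `β : B → B(F_U(H))`. -/
def actRep (h : IsTROEquivalence A B M) (X : NormalRep A) :
    B →ₐ[ℂ] (FUSpace h X →L[ℂ] FUSpace h X) :=
  AlgHom.ofLinearMap
    { toFun := actCLM h X
      map_add' := fun b c => FUSpace.hom_ext fun T x => by
        have e : mulU (b + c) T = mulU b T + mulU c T := by
          ext; simp [mulU, compLeft, LinearMap.restrict]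
        rw [add_apply, actCLM_tmul, actCLM_tmul, actCLM_tmul, e, FUSpace.tmul_add_left]
      map_smul' := fun c b => FUSpace.hom_ext fun T x => by
        have e : mulU (c • b) T = c • mulU b T := by
          ext; simp [mulU, compLeft, LinearMap.restrict]
        rw [smul_apply, RingHom.id_apply, actCLM_tmul, actCLM_tmul, e, FUSpace.tmul_smul_left] }
    (FUSpace.hom_ext fun T x => by
      change actCLM h X 1 _ = _
      rw [actCLM_tmul]
      rfl)
    (fun b c => FUSpace.hom_ext fun T x => by
      change actCLM h X (b * c) _ = actCLM h X b (actCLM h X c _)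
      rw [actCLM_tmul, actCLM_tmul, actCLM_tmul]
      rfl)

/-- `T ⊗ x ↦ T ⊗ f(x)`, for an `A`-module map `f`. -/
def preMap (h : IsTROEquivalence A B M) {X Y : NormalRep A} (f : NormalRep.Hom X Y) :
    PreFU h X →L[ℂ] PreFU h Y :=
  LinearMap.mkContinuous
    (show (bimodU B M) ⊗[ℂ] X.carrier →ₗ[ℂ] (bimodU B M) ⊗[ℂ] Y.carrier from
      f.toCLM.toLinearMap.lTensor (bimodU B M)) ‖f.toCLM‖ (fun z => by
    change supNorm h Y (f.toCLM.toLinearMap.lTensor (bimodU B M) z) ≤ ‖f.toCLM‖ * supNorm h X z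
    refine ciSup_le fun S => ?_
    have e : ∀ i, PiLp.projₗ (𝕜 := ℂ) 2 (fun _ : Fin S.1 => Y.carrier) i ∘ₗ
        colEval h Y S.2.1 ∘ₗ f.toCLM.toLinearMap.lTensor (bimodU B M) =
        f.toCLM.toLinearMap ∘ₗ PiLp.projₗ (𝕜 := ℂ) 2 (fun _ : Fin S.1 => X.carrier) i ∘ₗ
          colEval h X S.2.1 := by
      intro i
      refine TensorProduct.ext' fun T x => ?_
      have hc := DFunLike.congr_fun (f.comm ⟨(S.2.1 i : K₀ →L[ℂ] H₀) ∘L (T : H₀ →L[ℂ] K₀),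
        h.comp_mem (S.2.1 i).2 T.2⟩) x
      simpa [colEval_tmul] using hc.symm
    have e' : ∀ i, colEval h Y S.2.1 (f.toCLM.toLinearMap.lTensor (bimodU B M) z) i
        = f.toCLM (colEval h X S.2.1 z i) := fun i => LinearMap.congr_fun (e i) z
    refine le_trans ?_ (mul_le_mul_of_nonneg_left (le_supNorm h X S z) (norm_nonneg _))
    refine le_of_sq_le_sq ?_ (by positivity)
    rw [mul_pow, PiLp.norm_sq_eq_of_L2, PiLp.norm_sq_eq_of_L2, Finset.mul_sum]
    refine Finset.sum_le_sum fun i _ => ?_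
    rw [e', ← mul_pow]
    exact pow_le_pow_left₀ (norm_nonneg _) (f.toCLM.le_opNorm _) 2)

/-- The operator `F_U(f) : F_U(X) → F_U(Y)`, the extension of `T ⊗ x ↦ T ⊗ f(x)`. -/
def mapCLM (h : IsTROEquivalence A B M) {X Y : NormalRep A} (f : NormalRep.Hom X Y) :
    FUSpace h X →L[ℂ] FUSpace h Y :=
  (preMap h f).completion

theorem mapCLM_tmul (h : IsTROEquivalence A B M) {X Y : NormalRep A} (f : NormalRep.Hom X Y)
    (T : bimodU B M) (x : X.carrier) :
    mapCLM h f (FUSpace.tmul h X T x) = FUSpace.tmul h Y T (f.toCLM x) :=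
  ContinuousLinearMap.completion_apply_coe _ _

/-- The assertion that the construction `H ↦ (F_U(H), β)` produces normal representations of
`B`: the norm of `F_U(H)` satisfies the parallelogram identity, so that `F_U(H)` is a Hilbert
space for the inner product obtained by polarization, and `β` is completely contractive and
w*-continuous. -/
structure FUWellDefined (h : IsTROEquivalence A B M) : Prop where
  parallelogram : ∀ X : NormalRep A, InnerProductSpaceable (FUSpace h X)
  completelyContractive : ∀ X : NormalRep A, IsCompletelyContractive (actRep h X)
  wstarContinuous : ∀ X : NormalRep A,
    letI : InnerProductSpace ℂ (FUSpace h X) :=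
      InnerProductSpace.ofNorm ℂ (parallelogram X).parallelogram_identity
    IsWStarContinuous (actRep h X)

/-- The object `(F_U(H), β)` of `_B M`. -/
def FUObj {h : IsTROEquivalence A B M} (w : FUWellDefined h) (X : NormalRep A) : NormalRep B :=
  letI : InnerProductSpace ℂ (FUSpace h X) :=
    InnerProductSpace.ofNorm ℂ (w.parallelogram X).parallelogram_identity
  { carrier := FUSpace h X
    rep := actRep h X
    completelyContractive := w.completelyContractive X
    wstarContinuous := w.wstarContinuous X }

/-- The functor `F_U : _A M → _B M`. -/
def FU {h : IsTROEquivalence A B M} (w : FUWellDefined h) :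
    CategoryTheory.Functor (NormalRep A) (NormalRep B) where
  obj X := FUObj w X
  map {X Y} f :=
    { toCLM := (mapCLM h f : FUSpace h X →L[ℂ] FUSpace h Y)
      comm := fun b => FUSpace.hom_ext fun T x => by
        change mapCLM h f (actCLM h X b _) = actCLM h Y b (mapCLM h f _)
        rw [actCLM_tmul, mapCLM_tmul, mapCLM_tmul, actCLM_tmul] }
  map_id X := NormalRep.Hom.ext (FUSpace.hom_ext fun T x => mapCLM_tmul h _ T x)
  map_comp {X Y Z} f g := NormalRep.Hom.ext (FUSpace.hom_ext fun T x => by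
    change mapCLM h _ _ = mapCLM h g (mapCLM h f _)
    rw [mapCLM_tmul, mapCLM_tmul, mapCLM_tmul]
    rfl)

end TRO

end DualOpAlg

end

/-!
The row operators `r = (m₁, …, mₙ)` with `mₖ ∈ M` and `‖r‖ ≤ 1` contain a net for which
`∑ mₖ mₖ* → 1` in the w*-topology: starting from vectors spanning `M H₀`, correct a finite family
by functional calculus of its own `∑ mₖ mₖ*`, which a TRO is closed under. Since `‖∑ mₖ mₖ*‖ ≤ 1`
factors through the column `(mₖ*)ₖ` over `V`, the norm of `z ∈ F_U(H)` is the limit of the Hilbert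
space norms `‖(α(mₖ* ·) z)ₖ‖`. Hence the parallelogram law holds, and polarization
gives `⟪m ⊗ x, z⟫ = ⟪x, α(m* ·) z⟫` for `m ∈ M`, where `α(m* ·) (T ⊗ y) = α(m* T) y`.

In particular the operators `α(m* ·)` separate the points of `F_U(H)`, and so the vectors `m ⊗ x`
span a dense subspace. For a `Δ(A)`-module map `f`, the operator `m ⊗ x ↦ m ⊗ f(x)` intertwines the
evaluations `α(m* ·)`, because `m* n ∈ Δ(A)` for `m, n ∈ M`; this bounds it by `‖f‖`. The inner
product formula turns the same intertwining relation into the identity for adjoints, and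
`m* b n ∈ Δ(A)` for `b ∈ Δ(B)` makes the operator a `Δ(B)`-module map.
-/

noncomputable section

namespace DualOpAlg

/-! ### The predual of a w*-closed space of operators -/

section L1

variable {I D : Type*} [NormedAddCommGroup D] [NormedSpace ℂ D] [CompleteSpace D]

theorem summable_l1_smul {ω : I → D} (hω : ∀ i, ‖ω i‖ ≤ 1) (c : lp (fun _ : I => ℂ) 1) :
    Summable fun i => c i • ω i := by
  have hc : Summable fun i => ‖c i‖ := by simpa using c.2.summable
  refine hc.of_norm_bounded fun i => ?_
  rw [norm_smul]
  exact mul_le_of_le_one_right (norm_nonneg _) (hω i)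

/-- The contraction `ℓ¹(I) → D`, `c ↦ ∑ cᵢ ωᵢ`, given by a family in the unit ball of `D`. -/
def l1Lift (ω : I → D) (hω : ∀ i, ‖ω i‖ ≤ 1) : lp (fun _ : I => ℂ) 1 →L[ℂ] D :=
  LinearMap.mkContinuous
    { toFun := fun c => ∑' i, c i • ω i
      map_add' := fun c d => by
        simp only [lp.coeFn_add, Pi.add_apply, add_smul]
        exact (summable_l1_smul hω c).tsum_add (summable_l1_smul hω d)
      map_smul' := fun a c => by
        simp only [lp.coeFn_smul, Pi.smul_apply, smul_assoc, RingHom.id_apply]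
        exact (summable_l1_smul hω c).tsum_const_smul a }
    1 (fun c => by
      have hc : Summable fun i => ‖c i‖ := by simpa using c.2.summable
      have hn : ∑' i, ‖c i‖ = ‖c‖ := by simp [lp.norm_eq_tsum_rpow (p := 1) (by simp)]
      rw [one_mul, ← hn]
      exact tsum_of_norm_bounded hc.hasSum fun i => by
        rw [norm_smul]
        exact mul_le_of_le_one_right (norm_nonneg _) (hω i))

theorem hasSum_l1Lift (ω : I → D) (hω : ∀ i, ‖ω i‖ ≤ 1) (c : lp (fun _ : I => ℂ) 1) :
    HasSum (fun i => c i • ω i) (l1Lift ω hω c) :=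
  (summable_l1_smul hω c).hasSum

theorem l1Lift_single [DecidableEq I] (ω : I → D) (hω : ∀ i, ‖ω i‖ ≤ 1) (i : I) (a : ℂ) :
    l1Lift ω hω (lp.single 1 i a) = a • ω i := by
  refine (hasSum_l1Lift ω hω _).unique ?_
  convert hasSum_single i fun j hj => ?_ using 1
  · simp
  · simp [Pi.single_eq_of_ne hj]

end L1

section Nuclear

variable {E F : Type*}
  [NormedAddCommGroup E] [InnerProductSpace ℂ E]
  [NormedAddCommGroup F] [InnerProductSpace ℂ F]

/-- The vector functional `T ↦ ⟨y, T x⟩` of `B(E, F)`. -/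
def vecFunctional (x : E) (y : F) : (E →L[ℂ] F) →L[ℂ] ℂ :=
  innerSL ℂ y ∘L ContinuousLinearMap.apply ℂ F x

@[simp]
theorem vecFunctional_apply (x : E) (y : F) (T : E →L[ℂ] F) :
    vecFunctional x y T = ⟪y, T x⟫_ℂ := rfl

theorem norm_vecFunctional_le (x : E) (y : F) : ‖vecFunctional x y‖ ≤ ‖x‖ * ‖y‖ := by
  refine ContinuousLinearMap.opNorm_le_bound _ (by positivity) fun T => ?_
  calc ‖⟪y, T x⟫_ℂ‖ ≤ ‖y‖ * (‖T‖ * ‖x‖) :=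
        (norm_inner_le_norm _ _).trans
          (mul_le_mul_of_nonneg_left (T.le_opNorm _) (norm_nonneg _))
    _ = _ := by ring

/-- Pairs of vectors in the unit balls. -/
abbrev BallPair (E F : Type*) [NormedAddCommGroup E] [NormedAddCommGroup F] : Type _ :=
  {p : E × F // ‖p.1‖ ≤ 1 ∧ ‖p.2‖ ≤ 1}

/-- The map `c ↦ ∑ cᵢ ⟨yᵢ, · xᵢ⟩` from `ℓ¹` over the pairs of unit ball vectors to the functionals
of `B(E, F)`. Its range is the predual of `B(E, F)`. -/
def nuclear (E F : Type*) [NormedAddCommGroup E] [InnerProductSpace ℂ E]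
    [NormedAddCommGroup F] [InnerProductSpace ℂ F] :
    lp (fun _ : BallPair E F => ℂ) 1 →L[ℂ] ((E →L[ℂ] F) →L[ℂ] ℂ) :=
  l1Lift (fun i : BallPair E F => vecFunctional i.1.1 i.1.2) fun i =>
    (norm_vecFunctional_le _ _).trans (mul_le_one₀ i.2.1 (norm_nonneg _) i.2.2)

theorem hasSum_nuclear (c : lp (fun _ : BallPair E F => ℂ) 1) (T : E →L[ℂ] F) :
    HasSum (fun i : BallPair E F => c i * ⟪i.1.2, T i.1.1⟫_ℂ) (nuclear E F c T) := by
  have hsum : HasSum _ (nuclear E F c) := hasSum_l1Lift _ _ c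
  simpa using hsum.mapL (ContinuousLinearMap.apply ℂ ℂ T)

open Classical in
/-- An element of `ℓ¹` that represents the functional `⟨y, · x⟩`. -/
def rankOne (x : E) (y : F) : lp (fun _ : BallPair E F => ℂ) 1 :=
  lp.single 1 (⟨(((‖x‖⁻¹ : ℝ) : ℂ) • x, ((‖y‖⁻¹ : ℝ) : ℂ) • y), by
    constructor <;> rw [norm_smul, Complex.norm_real, norm_inv, norm_norm] <;>
      exact inv_mul_le_one⟩ : BallPair E F) ((‖x‖ * ‖y‖ : ℝ) : ℂ)

theorem norm_rankOne_le (x : E) (y : F) : ‖rankOne x y‖ ≤ ‖x‖ * ‖y‖ := by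
  classical
  rw [rankOne, lp.norm_single one_pos, Complex.norm_real, Real.norm_of_nonneg (by positivity)]

theorem nuclear_rankOne (x : E) (y : F) : nuclear E F (rankOne x y) = vecFunctional x y := by
  classical
  rw [nuclear, rankOne, l1Lift_single]
  ext T
  rcases eq_or_ne x 0 with rfl | hx
  · simp
  rcases eq_or_ne y 0 with rfl | hy
  · simp
  have hx' : (‖x‖ : ℂ) ≠ 0 := by simpa using hx
  have hy' : (‖y‖ : ℂ) ≠ 0 := by simpa using hy
  simp only [smul_apply, vecFunctional_apply, map_smul, inner_smul_left, inner_smul_right,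
    smul_eq_mul, Complex.ofReal_mul, Complex.ofReal_inv, map_inv₀, Complex.conj_ofReal]
  field_simp

omit [InnerProductSpace ℂ E] [InnerProductSpace ℂ F] in
theorem SqSummablePair.summable_norm_mul_norm (p : SqSummablePair E F) :
    Summable fun n => ‖p.1.1 n‖ * ‖p.1.2 n‖ :=
  (p.2.1.add p.2.2).of_nonneg_of_le (fun _ => by positivity) fun n => by
    nlinarith [two_mul_le_add_sq ‖p.1.1 n‖ ‖p.1.2 n‖, norm_nonneg (p.1.1 n), norm_nonneg (p.1.2 n)]

theorem exists_nuclear_eq_wstarEval (p : SqSummablePair E F) :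
    ∃ c, ∀ T, nuclear E F c T = wstarEval E F T p := by
  have hs : Summable fun n => rankOne (p.1.1 n) (p.1.2 n) :=
    p.summable_norm_mul_norm.of_norm_bounded fun n => norm_rankOne_le _ _
  refine ⟨∑' n, rankOne (p.1.1 n) (p.1.2 n), fun T => ?_⟩
  have hsum := (hs.hasSum.mapL (nuclear E F)).mapL (ContinuousLinearMap.apply ℂ ℂ T)
  simp only [nuclear_rankOne, ContinuousLinearMap.apply_apply, vecFunctional_apply] at hsum
  exact hsum.tsum_eq.symm

theorem summable_sq_norm_extend {I G : Type*} [NormedAddCommGroup G] {e : I → ℕ}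
    (he : Function.Injective e) {z : I → G} (hz : Summable fun i => ‖z i‖ ^ 2) :
    Summable fun n => ‖Function.extend e z 0 n‖ ^ 2 := by
  refine ((summable_extend_zero he).2 hz).congr fun n => ?_
  rw [Function.apply_extend fun v : G => ‖v‖ ^ 2]
  congr
  ext
  simp

theorem exists_hasSum_wstarEval_of_injective {I : Type*} {e : I → ℕ} (he : Function.Injective e)
    {x : I → E} {y : I → F} (hx : Summable fun i => ‖x i‖ ^ 2) (hy : Summable fun i => ‖y i‖ ^ 2) :
    ∃ p, ∀ T, HasSum (fun i => ⟪y i, T (x i)⟫_ℂ) (wstarEval E F T p) := by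
  refine ⟨⟨(Function.extend e x 0, Function.extend e y 0),
    summable_sq_norm_extend he hx, summable_sq_norm_extend he hy⟩, fun T => ?_⟩
  have hext : (fun n => ⟪Function.extend e y 0 n, T (Function.extend e x 0 n)⟫_ℂ) =
      Function.extend e (fun i => ⟪y i, T (x i)⟫_ℂ) 0 := by
    ext n
    by_cases hn : ∃ i, e i = n
    · obtain ⟨i, rfl⟩ := hn
      simp [he.extend_apply]
    · simp [Function.extend_apply' _ _ _ hn]
  rw [← hasSum_extend_zero he, ← hext]
  exact (SqSummablePair.summable _ T).hasSum

theorem exists_hasSum_wstarEval {I : Type*} {x : I → E} {y : I → F}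
    (hx : Summable fun i => ‖x i‖ ^ 2) (hy : Summable fun i => ‖y i‖ ^ 2) :
    ∃ p, ∀ T, HasSum (fun i => ⟪y i, T (x i)⟫_ℂ) (wstarEval E F T p) := by
  have := hx.countable_support.to_subtype
  obtain ⟨e, he⟩ := exists_injective_nat (Function.support fun i => ‖x i‖ ^ 2)
  obtain ⟨p, hp⟩ := exists_hasSum_wstarEval_of_injective he (hx.subtype _) (hy.subtype _)
  refine ⟨p, fun T => (hasSum_subtype_iff_of_support_subset fun i hi => ?_).1 (hp T)⟩
  contrapose! hi
  simp_all

theorem exists_wstarEval_eq_nuclear (c : lp (fun _ : BallPair E F => ℂ) 1) :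
    ∃ p, ∀ T, nuclear E F c T = wstarEval E F T p := by
  have hc : Summable fun i => ‖c i‖ := by simpa using c.2.summable
  let r : BallPair E F → ℂ := fun i => (√‖c i‖ : ℝ)
  have hr : ∀ i, ‖r i‖ ^ 2 = ‖c i‖ := fun i => by simp [r]
  have hx : Summable fun i => ‖(c i / r i) • i.1.1‖ ^ 2 :=
    hc.of_nonneg_of_le (fun _ => sq_nonneg _) fun i => by
      rw [norm_smul, mul_pow, norm_div, div_pow, hr, sq, mul_self_div_self]
      exact mul_le_of_le_one_right (norm_nonneg _) (pow_le_one₀ (norm_nonneg _) i.2.1)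
  have hy : Summable fun i => ‖r i • i.1.2‖ ^ 2 :=
    hc.of_nonneg_of_le (fun _ => sq_nonneg _) fun i => by
      rw [norm_smul, mul_pow, hr]
      exact mul_le_of_le_one_right (norm_nonneg _) (pow_le_one₀ (norm_nonneg _) i.2.2)
  obtain ⟨p, hp⟩ := exists_hasSum_wstarEval hx hy
  refine ⟨p, fun T => (hasSum_nuclear c T).unique ?_⟩
  convert hp T using 2 with i
  have hconj : starRingEnd ℂ (r i) = r i := Complex.conj_ofReal _
  have hdiv : r i * (c i / r i) = c i := by
    refine mul_div_cancel_of_imp' fun h0 => ?_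
    simpa [h0] using (hr i).symm
  rw [map_smul, inner_smul_left, inner_smul_right, hconj, ← mul_assoc, hdiv]

theorem continuous_wstarEval (p : SqSummablePair E F) :
    Continuous[wstarTopology E F, inferInstance] fun T => wstarEval E F T p := by
  let : TopologicalSpace (E →L[ℂ] F) := wstarTopology E F
  exact (continuous_apply p).comp continuous_induced_dom

theorem continuous_nuclear (c : lp (fun _ : BallPair E F => ℂ) 1) :
    Continuous[wstarTopology E F, inferInstance] (nuclear E F c) := by
  obtain ⟨p, hp⟩ := exists_wstarEval_eq_nuclear c
  rw [funext hp]
  exact continuous_wstarEval p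

theorem wstar_continuous_inner (x : E) (y : F) :
    Continuous[wstarTopology E F, inferInstance] fun T : E →L[ℂ] F => ⟪y, T x⟫_ℂ := by
  simpa only [nuclear_rankOne] using! continuous_nuclear (rankOne x y)

theorem exists_nuclear_eq_of_continuous {V : Type*} [AddCommGroup V] [Module ℂ V]
    (j : V →ₗ[ℂ] (E →L[ℂ] F)) (f : V →ₗ[ℂ] ℂ)
    (hf : Continuous[TopologicalSpace.induced j (wstarTopology E F), inferInstance] f) :
    ∃ c, ∀ T, f T = nuclear E F c (j T) := by
  let g : SqSummablePair E F → V →ₗ[ℂ] ℂ := fun p => LinearMap.proj p ∘ₗ wstarEval E F ∘ₗ j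
  have htop : TopologicalSpace.induced j (wstarTopology E F) =
      ⨅ p, TopologicalSpace.induced (g p) inferInstance := by
    rw [wstarTopology, induced_compose, Pi.topologicalSpace, induced_iInf]
    exact iInf_congr fun p => induced_compose
  have hfg : f ∈ Submodule.span ℂ (Set.range g) := by
    rwa [LinearMap.mem_span_iff_continuous, ← htop]
  clear hf
  induction hfg using Submodule.span_induction with
  | mem f hf =>
    obtain ⟨p, rfl⟩ := hf
    obtain ⟨c, hc⟩ := exists_nuclear_eq_wstarEval p
    exact ⟨c, fun T => (hc _).symm⟩
  | zero => exact ⟨0, by simp⟩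
  | add f f' _ _ h h' =>
    obtain ⟨c, hc⟩ := h
    obtain ⟨c', hc'⟩ := h'
    exact ⟨c + c', by simp [hc, hc']⟩
  | smul a f _ h =>
    obtain ⟨c, hc⟩ := h
    exact ⟨a • c, by simp [hc]⟩

theorem exists_nuclear_ne_zero {W : Submodule ℂ (E →L[ℂ] F)}
    (hW : IsClosed[wstarTopology E F] (W : Set (E →L[ℂ] F))) {T : E →L[ℂ] F} (hT : T ∉ W) :
    ∃ c, (∀ S ∈ W, nuclear E F c S = 0) ∧ nuclear E F c T ≠ 0 := by
  let _ : TopologicalSpace (E →L[ℂ] F) := wstarTopology E F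
  have : IsTopologicalAddGroup (E →L[ℂ] F) := topologicalAddGroup_induced (wstarEval E F)
  have : ContinuousSMul ℂ (E →L[ℂ] F) := continuousSMul_induced (wstarEval E F)
  have : LocallyConvexSpace ℝ (E →L[ℂ] F) :=
    LocallyConvexSpace.induced ((wstarEval E F).restrictScalars ℝ)
  have hconv : Convex ℝ (W : Set (E →L[ℂ] F)) := (W.restrictScalars ℝ).convex
  obtain ⟨f, u, hfW, hfT⟩ := RCLike.geometric_hahn_banach_closed_point (𝕜 := ℂ) hconv hW hT
  have hf0 : ∀ S ∈ W, f S = 0 := fun S hS => by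
    by_contra hfS
    have := hfW _ (W.smul_mem ((u : ℂ) / f S) hS)
    simp [hfS] at this
  obtain ⟨c, hc⟩ := exists_nuclear_eq_of_continuous LinearMap.id f.toLinearMap
    (by rw [LinearMap.id_coe, induced_id]; exact f.continuous)
  refine ⟨c, fun S hS => (hc S).symm.trans (hf0 S hS), fun h0 => ?_⟩
  have hu : 0 < u := by simpa using hfW 0 W.zero_mem
  have hfT0 : f T = 0 := (hc T).trans h0
  rw [hfT0, map_zero] at hfT
  exact hu.not_gt hfT

end Nuclear

section WStarDual

variable {E F V : Type*}
  [NormedAddCommGroup E] [InnerProductSpace ℂ E]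
  [NormedAddCommGroup F] [InnerProductSpace ℂ F]
  [NormedAddCommGroup V] [NormedSpace ℂ V]

/-- The functionals on `V` that a sequence in `ℓ¹` gives through `j`. -/
def nuclearOn (j : V →ₗᵢ[ℂ] (E →L[ℂ] F)) :
    lp (fun _ : BallPair E F => ℂ) 1 →L[ℂ] (V →L[ℂ] ℂ) :=
  ContinuousLinearMap.precomp ℂ j.toContinuousLinearMap ∘L nuclear E F

/-- The w*-continuous functionals on a space of operators, as a subspace of its dual. The space
is presented by an isometric embedding `j`, so that its norm and its w*-topology can coexist. -/
def wstarDual (j : V →ₗᵢ[ℂ] (E →L[ℂ] F)) : Submodule ℂ (V →L[ℂ] ℂ) :=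
  (nuclearOn j).range

theorem mem_wstarDual {j : V →ₗᵢ[ℂ] (E →L[ℂ] F)} {f : V →L[ℂ] ℂ} : f ∈ wstarDual j ↔
    Continuous[TopologicalSpace.induced j (wstarTopology E F), inferInstance] f := by
  constructor
  · rintro ⟨c, rfl⟩
    exact @Continuous.comp V _ _ (_) (_) _ j _ (continuous_nuclear c) continuous_induced_dom
  · intro hf
    obtain ⟨c, hc⟩ := exists_nuclear_eq_of_continuous j.toLinearMap f.toLinearMap hf
    exact ⟨c, ContinuousLinearMap.ext fun v => (hc v).symm⟩

variable [CompleteSpace E] [CompleteSpace F]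

theorem exists_operator_of_sesquilinear (b : F →ₗ⋆[ℂ] E →ₗ[ℂ] ℂ) {C : ℝ} (hC : 0 ≤ C)
    (hb : ∀ y x, ‖b y x‖ ≤ C * ‖y‖ * ‖x‖) :
    ∃ T : E →L[ℂ] F, ‖T‖ ≤ C ∧ ∀ x y, ⟪y, T x⟫_ℂ = b y x := by
  let R : F →L[ℂ] E :=
    ((InnerProductSpace.toDual ℂ E).symm : (E →L[ℂ] ℂ) →L⋆[ℂ] E) ∘SL b.mkContinuous₂ C hb
  refine ⟨R.adjoint, ?_, fun x y => ?_⟩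
  · rw [LinearIsometryEquiv.norm_map]
    refine R.opNorm_le_bound hC fun y => ?_
    rw [show ‖R y‖ = _ from (InnerProductSpace.toDual ℂ E).symm.norm_map _]
    exact ContinuousLinearMap.opNorm_le_bound _ (by positivity) (hb y)
  · rw [R.adjoint_inner_right]
    exact InnerProductSpace.toDual_symm_apply

theorem exists_operator_of_ker_le {g : lp (fun _ : BallPair E F => ℂ) 1 →L[ℂ] ℂ}
    (hg : (nuclear E F).ker ≤ g.ker) :
    ∃ T : E →L[ℂ] F, ‖T‖ ≤ ‖g‖ ∧ ∀ c, g c = nuclear E F c T := by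
  classical
  have hcongr : ∀ {c d}, nuclear E F c = nuclear E F d → g c = g d := fun {c d} h =>
    LinearMap.sub_mem_ker_iff.1 (hg (LinearMap.sub_mem_ker_iff.2 h))
  let b : F →ₗ⋆[ℂ] E →ₗ[ℂ] ℂ := LinearMap.mk₂'ₛₗ (starRingEnd ℂ) (RingHom.id ℂ)
    (fun y x => g (rankOne x y))
    (fun y y' x => by rw [← map_add]; exact hcongr (by ext T; simp [nuclear_rankOne]))
    (fun a y x => by rw [← map_smul]; exact hcongr (by ext T; simp [nuclear_rankOne, mul_comm]))
    (fun y x x' => by rw [← map_add]; exact hcongr (by ext T; simp [nuclear_rankOne]))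
    (fun a y x => by
      rw [RingHom.id_apply, ← map_smul]
      exact hcongr (by ext T; simp [nuclear_rankOne]))
  obtain ⟨T, hT, hTb⟩ := exists_operator_of_sesquilinear b (norm_nonneg g) fun y x => by
    rw [mul_assoc, mul_comm ‖y‖]
    exact g.le_opNorm_of_le (norm_rankOne_le x y)
  have heval : g = ContinuousLinearMap.apply ℂ ℂ T ∘L nuclear E F := by
    refine lp.ext_continuousLinearMap (by simp) fun i => ContinuousLinearMap.ext_ring ?_
    have hsingle : nuclear E F (lp.single 1 i 1) = nuclear E F (rankOne i.1.1 i.1.2) := by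
      rw [nuclear_rankOne, nuclear, l1Lift_single, one_smul]
    calc g (lp.single 1 i 1) = ⟪i.1.2, T i.1.1⟫_ℂ := (hcongr hsingle).trans (hTb _ _).symm
      _ = nuclear E F (lp.single 1 i 1) T := by
        rw [hsingle, nuclear_rankOne, vecFunctional_apply]
  exact ⟨T, hT, fun c => DFunLike.congr_fun heval c⟩

theorem norm_mk_le_norm_nuclearOn {j : V →ₗᵢ[ℂ] (E →L[ℂ] F)}
    (hj : IsClosed[wstarTopology E F] (j.toLinearMap.range : Set (E →L[ℂ] F)))
    (c : lp (fun _ : BallPair E F => ℂ) 1) :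
    ‖(nuclearOn j).ker.mkQ c‖ ≤ ‖nuclearOn j c‖ := by
  obtain ⟨g, hg1, hg⟩ := exists_dual_vector'' ℂ ((nuclearOn j).ker.mkQ c)
  let g' : lp (fun _ : BallPair E F => ℂ) 1 →L[ℂ] ℂ := g ∘L (nuclearOn j).ker.mkQL
  have hker : (nuclearOn j).ker ≤ g'.ker := fun d hd => by
    have : (nuclearOn j).ker.mkQ d = 0 := (Submodule.Quotient.mk_eq_zero _).2 hd
    exact (congrArg g this).trans (map_zero g)
  obtain ⟨T, hT, hTg⟩ := exists_operator_of_ker_le (g := g') fun d hd =>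
    hker (congrArg (ContinuousLinearMap.precomp ℂ j.toContinuousLinearMap) hd)
  obtain ⟨v, rfl⟩ : T ∈ j.toLinearMap.range := by
    by_contra hcon
    obtain ⟨d, hd, hdT⟩ := exists_nuclear_ne_zero hj hcon
    have hd0 : d ∈ (nuclearOn j).ker := ContinuousLinearMap.ext fun v => hd _ ⟨v, rfl⟩
    exact hdT ((hTg d).symm.trans (hker hd0))
  have hv : ‖v‖ ≤ 1 := by
    refine (j.norm_map v).symm.trans_le (hT.trans (g'.opNorm_le_bound zero_le_one fun d => ?_))
    exact (g.le_of_opNorm_le hg1 _).trans (by gcongr; exact Submodule.Quotient.norm_mk_le _ d)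
  calc ‖(nuclearOn j).ker.mkQ c‖ = ‖g' c‖ := by
        rw [show g' c = _ from hg]; simp
    _ = ‖nuclearOn j c v‖ := by rw [hTg]; rfl
    _ ≤ ‖nuclearOn j c‖ := ((nuclearOn j c).le_opNorm _).trans
        (mul_le_of_le_one_right (norm_nonneg _) hv)

theorem isClosed_wstarDual {j : V →ₗᵢ[ℂ] (E →L[ℂ] F)}
    (hj : IsClosed[wstarTopology E F] (j.toLinearMap.range : Set (E →L[ℂ] F))) :
    IsClosed (wstarDual j : Set (V →L[ℂ] ℂ)) := by
  have : IsClosed ((nuclearOn j).ker : Set (lp (fun _ : BallPair E F => ℂ) 1)) :=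
    (nuclearOn j).isClosed_ker
  let q : (lp (fun _ : BallPair E F => ℂ) 1 ⧸ (nuclearOn j).ker) →L[ℂ] (V →L[ℂ] ℂ) :=
    (nuclearOn j).ker.liftQL (nuclearOn j) le_rfl
  have hq : AntilipschitzWith 1 q := AddMonoidHomClass.antilipschitz_of_bound q fun z => by
    obtain ⟨c, rfl⟩ := (nuclearOn j).ker.mkQ_surjective z
    rw [NNReal.coe_one, one_mul]
    exact norm_mk_le_norm_nuclearOn hj c
  have hrange : (wstarDual j : Set (V →L[ℂ] ℂ)) = Set.range q :=
    congrArg SetLike.coe (Submodule.range_liftQ _ _ _).symm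
  rw [hrange]
  exact hq.isClosed_range q.uniformContinuous

end WStarDual

section MatrixCoefficients

theorem map_mem_of_dense_span {G D : Type*} {σ : ℂ →+* ℂ} [AddCommGroup G] [Module ℂ G]
    [TopologicalSpace G] [AddCommGroup D] [Module ℂ D] [TopologicalSpace D]
    {s : Set G} (hs : Dense (Submodule.span ℂ s : Set G)) {W : Submodule ℂ D}
    (hW : IsClosed (W : Set D)) (f : G →SL[σ] D) (hf : ∀ x ∈ s, f x ∈ W) (x : G) : f x ∈ W :=
  closure_minimal (fun _ => Submodule.span_induction (p := fun x _ => f x ∈ W) hf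
    (by rw [map_zero]; exact W.zero_mem)
    (fun x y _ _ hx hy => by rw [map_add]; exact W.add_mem hx hy)
    (fun a x _ hx => by rw [map_smulₛₗ]; exact W.smul_mem _ hx))
    (hW.preimage f.continuous) (hs x)

variable {E F V G₁ G₂ : Type*}
  [NormedAddCommGroup E] [InnerProductSpace ℂ E]
  [NormedAddCommGroup F] [InnerProductSpace ℂ F]
  [NormedAddCommGroup V] [NormedSpace ℂ V]
  [NormedAddCommGroup G₁] [InnerProductSpace ℂ G₁]
  [NormedAddCommGroup G₂] [InnerProductSpace ℂ G₂]

/-- The functional `v ↦ ⟪y, π v x⟫`, a matrix coefficient of `π`. -/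
def matrixCoeff (π : V →L[ℂ] (G₁ →L[ℂ] G₂)) (x : G₁) (y : G₂) : V →L[ℂ] ℂ :=
  innerSL ℂ y ∘L π.flip x

theorem norm_matrixCoeff_le (π : V →L[ℂ] (G₁ →L[ℂ] G₂)) (x : G₁) (y : G₂) :
    ‖matrixCoeff π x y‖ ≤ ‖π‖ * (‖x‖ * ‖y‖) :=
  calc ‖matrixCoeff π x y‖ ≤ ‖innerSL ℂ y‖ * ‖π.flip x‖ := ContinuousLinearMap.opNorm_comp_le _ _
    _ ≤ ‖y‖ * (‖π‖ * ‖x‖) := by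
      rw [innerSL_apply_norm, ← π.opNorm_flip]
      gcongr
      exact π.flip.le_opNorm x
    _ = ‖π‖ * (‖x‖ * ‖y‖) := by ring

theorem matrixCoeff_mem_of_dense {W : Submodule ℂ (V →L[ℂ] ℂ)}
    (hW : IsClosed (W : Set (V →L[ℂ] ℂ))) (π : V →L[ℂ] (G₁ →L[ℂ] G₂))
    {s : Set G₁} (hs : Dense (Submodule.span ℂ s : Set G₁))
    {t : Set G₂} (ht : Dense (Submodule.span ℂ t : Set G₂))
    (hst : ∀ x ∈ s, ∀ y ∈ t, matrixCoeff π x y ∈ W) (x : G₁) (y : G₂) : matrixCoeff π x y ∈ W :=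
  map_mem_of_dense_span ht hW
    ((ContinuousLinearMap.compL ℂ V G₂ ℂ).flip (π.flip x) ∘SL innerSL ℂ)
    (fun y hy => map_mem_of_dense_span hs hW
      (ContinuousLinearMap.compL ℂ V G₂ ℂ (innerSL ℂ y) ∘L π.flip)
      (fun x hx => hst x hx y hy) x) y

theorem continuous_wstar_of_dense [CompleteSpace E] [CompleteSpace F]
    {j : V →ₗᵢ[ℂ] (E →L[ℂ] F)}
    (hj : IsClosed[wstarTopology E F] (j.toLinearMap.range : Set (E →L[ℂ] F)))
    (π : V →L[ℂ] (G₁ →L[ℂ] G₂))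
    {s : Set G₁} (hs : Dense (Submodule.span ℂ s : Set G₁))
    {t : Set G₂} (ht : Dense (Submodule.span ℂ t : Set G₂))
    (hst : ∀ x ∈ s, ∀ y ∈ t, matrixCoeff π x y ∈ wstarDual j) :
    Continuous[TopologicalSpace.induced j (wstarTopology E F), wstarTopology G₁ G₂] π := by
  have hmem := matrixCoeff_mem_of_dense (isClosed_wstarDual hj) π hs ht hst
  have heval (p : SqSummablePair G₁ G₂) :
      Continuous[TopologicalSpace.induced j (wstarTopology E F), inferInstance]
        fun v => wstarEval G₁ G₂ (π v) p := by
    have hsum : Summable fun n => matrixCoeff π (p.1.1 n) (p.1.2 n) :=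
      .of_norm_bounded (p.summable_norm_mul_norm.mul_left ‖π‖) fun n => norm_matrixCoeff_le _ _ _
    have htsum : ∑' n, matrixCoeff π (p.1.1 n) (p.1.2 n) ∈ wstarDual j :=
      (isClosed_wstarDual hj).mem_of_tendsto hsum.hasSum
        (.of_forall fun _ => Submodule.sum_mem _ fun n _ => hmem _ _)
    convert mem_wstarDual.1 htsum using 2 with v
    exact ((ContinuousLinearMap.apply ℂ ℂ v).hasSum hsum.hasSum).tsum_eq
  let : TopologicalSpace V := TopologicalSpace.induced j (wstarTopology E F)
  exact continuous_induced_rng.2 (continuous_pi heval)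

end MatrixCoefficients

/-! ### Contractive approximate units of a TRO -/

section ApproximateUnit

open Polynomial Filter ContinuousLinearMap

theorem exists_polynomial_near_inv_sqrt (R : ℝ) {δ : ℝ} (hδ : 0 < δ) :
    ∃ p : ℝ[X], ∀ t ∈ Set.Icc 0 R,
      |t * p.eval t ^ 2| ≤ 1 ∧ |t * (1 - t * p.eval t ^ 2) ^ 2| ≤ δ := by
  let X₀ : C(Set.Icc 0 R, ℝ) := ⟨Subtype.val, continuous_subtype_val⟩
  let U : Set C(Set.Icc 0 R, ℝ) := {f | ‖X₀ * f ^ 2‖ < 1 ∧ ‖X₀ * (1 - X₀ * f ^ 2) ^ 2‖ < δ}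
  have hU : IsOpen U := by
    have hcont₁ : Continuous fun f : C(Set.Icc 0 R, ℝ) => ‖X₀ * f ^ 2‖ := by fun_prop
    have hcont₂ : Continuous fun f : C(Set.Icc 0 R, ℝ) => ‖X₀ * (1 - X₀ * f ^ 2) ^ 2‖ := by
      fun_prop
    exact (isOpen_lt hcont₁ continuous_const).inter (isOpen_lt hcont₂ continuous_const)
  have hne (t : Set.Icc 0 R) : √(t + δ) ≠ 0 := (Real.sqrt_pos.2 (by linarith [t.2.1])).ne'
  have hUne : U.Nonempty := by
    refine ⟨⟨fun t => (√(t + δ))⁻¹, (by fun_prop : Continuous _).inv₀ hne⟩, ?_, ?_⟩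
    all_goals
      refine (ContinuousMap.norm_lt_iff _ (by positivity)).2 fun t => ?_
      have ht : 0 ≤ (t : ℝ) := t.2.1
      have htδ : 0 < (t : ℝ) + δ := by linarith
      have hsq : (√(t + δ))⁻¹ ^ 2 = (t + δ : ℝ)⁻¹ := by rw [inv_pow, Real.sq_sqrt htδ.le]
    · change ‖(t : ℝ) * (√(t + δ))⁻¹ ^ 2‖ < 1
      rw [hsq, ← div_eq_mul_inv, Real.norm_of_nonneg (by positivity), div_lt_one htδ]
      linarith
    · change ‖(t : ℝ) * (1 - t * (√(t + δ))⁻¹ ^ 2) ^ 2‖ < δ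
      have hsub : 1 - (t : ℝ) * (t + δ)⁻¹ = δ / (t + δ) := by field_simp; ring
      rw [hsq, hsub, Real.norm_of_nonneg (by positivity), div_pow, ← mul_div_assoc,
        div_lt_iff₀ (by positivity)]
      nlinarith [mul_nonneg ht hδ.le, sq_nonneg (t : ℝ), pow_pos hδ 3,
        mul_nonneg hδ.le (sq_nonneg (t : ℝ)), mul_nonneg ht (sq_nonneg δ)]
  have hdense : Dense (polynomialFunctions (Set.Icc 0 R) : Set C(Set.Icc 0 R, ℝ)) := fun f =>
    continuousMap_mem_polynomialFunctions_closure 0 R f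
  obtain ⟨_, ⟨hbounded, hsmall⟩, p, -, rfl⟩ := hdense.inter_open_nonempty U hU hUne
  exact ⟨p, fun t ht => ⟨(ContinuousMap.norm_coe_le_norm _ ⟨t, ht⟩).trans hbounded.le,
    (ContinuousMap.norm_coe_le_norm _ ⟨t, ht⟩).trans hsmall.le⟩⟩

variable {H K : Type*} [NormedAddCommGroup H] [InnerProductSpace ℂ H] [CompleteSpace H]
  [NormedAddCommGroup K] [InnerProductSpace ℂ K] [CompleteSpace K]

theorem norm_aeval_le {a : K →L[ℂ] K} (ha : 0 ≤ a) {q : ℝ[X]} {c : ℝ} (hc : 0 ≤ c)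
    (hq : ∀ t ∈ Set.Icc 0 ‖a‖, |q.eval t| ≤ c) : ‖aeval a q‖ ≤ c := by
  rw [← cfc_polynomial q a (.of_nonneg ha)]
  refine norm_cfc_le hc fun t ht => hq t ⟨spectrum_nonneg_of_nonneg ha ht, ?_⟩
  calc t ≤ ‖t‖ := le_abs_self t
    _ ≤ ‖a‖ * ‖(1 : K →L[ℂ] K)‖ :=
      mem_closedBall_zero_iff.1 (spectrum.subset_closedBall_norm_mul a ht)
    _ ≤ ‖a‖ := mul_le_of_le_one_right (norm_nonneg a) norm_id_le

theorem adjoint_aeval {a : K →L[ℂ] K} (ha : IsSelfAdjoint a) (q : ℝ[X]) :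
    (aeval a q).adjoint = aeval a q := by
  rw [← cfc_polynomial q a ha]
  exact (cfc_predicate (p := IsSelfAdjoint) _ a).adjoint_eq

/-- The operator `∑ mₖ mₖ*` of a finite family of operators. -/
def sumMulAdjoint {ι : Type*} [Fintype ι] (m : ι → H →L[ℂ] K) : K →L[ℂ] K :=
  ∑ k, m k ∘L (m k).adjoint

section SumMulAdjoint

variable {ι : Type*} [Fintype ι] (m : ι → H →L[ℂ] K)

theorem sumMulAdjoint_apply (y : K) : sumMulAdjoint m y = ∑ k, m k ((m k).adjoint y) := by
  simp [sumMulAdjoint]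

theorem sumMulAdjoint_nonneg : 0 ≤ sumMulAdjoint m := by
  rw [nonneg_iff_isPositive]
  exact isPositive_sum Finset.univ fun k _ => isPositive_self_comp_adjoint (m k)

theorem sum_norm_adjoint_sq (y : K) :
    ∑ k, ‖(m k).adjoint y‖ ^ 2 = RCLike.re ⟪y, sumMulAdjoint m y⟫_ℂ := by
  rw [sumMulAdjoint_apply, inner_sum, map_sum]
  exact Finset.sum_congr rfl fun k _ => by rw [← adjoint_inner_left, inner_self_eq_norm_sq]

theorem sum_norm_adjoint_aeval_sq_le {q : ℝ[X]} {c : ℝ} (hc : 0 ≤ c)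
    (hq : ∀ t ∈ Set.Icc 0 ‖sumMulAdjoint m‖, |t * q.eval t ^ 2| ≤ c) (y : K) :
    ∑ k, ‖(m k).adjoint (aeval (sumMulAdjoint m) q y)‖ ^ 2 ≤ c * ‖y‖ ^ 2 := by
  set a := sumMulAdjoint m with ha
  have hfactor : aeval a (X * q ^ 2) = aeval a q * (a * aeval a q) := by
    rw [show X * q ^ 2 = q * (X * q) by ring, map_mul, map_mul, aeval_X]
  calc ∑ k, ‖(m k).adjoint (aeval a q y)‖ ^ 2
      = RCLike.re ⟪y, aeval a (X * q ^ 2) y⟫_ℂ := by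
        rw [sum_norm_adjoint_sq, ← ha, hfactor,
          ← adjoint_aeval (.of_nonneg (sumMulAdjoint_nonneg m)),
          adjoint_inner_left, ← ha, adjoint_aeval (.of_nonneg (sumMulAdjoint_nonneg m))]
        rfl
    _ ≤ ‖y‖ * ‖aeval a (X * q ^ 2) y‖ := re_inner_le_norm _ _
    _ ≤ ‖y‖ * (c * ‖y‖) := by
        gcongr
        refine le_of_opNorm_le _ (norm_aeval_le (sumMulAdjoint_nonneg m) hc fun t ht => ?_) y
        simpa using hq t ht
    _ = c * ‖y‖ ^ 2 := by ring

theorem sumMulAdjoint_aeval_comp (q : ℝ[X]) :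
    sumMulAdjoint (fun k => aeval (sumMulAdjoint m) q ∘L m k) =
      aeval (sumMulAdjoint m) (X * q ^ 2) := by
  rw [show X * q ^ 2 = q * (X * q) by ring, map_mul, map_mul, aeval_X]
  ext y
  simp only [sumMulAdjoint_apply, adjoint_comp,
    adjoint_aeval (.of_nonneg (sumMulAdjoint_nonneg m)), mul_apply_eq_comp, comp_apply, map_sum]

variable {m}

theorem norm_sum_apply_sq_le (hm : ∀ y, ∑ k, ‖(m k).adjoint y‖ ^ 2 ≤ ‖y‖ ^ 2) (v : ι → H) :
    ‖∑ k, m k (v k)‖ ^ 2 ≤ ∑ k, ‖v k‖ ^ 2 := by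
  set w := ∑ k, m k (v k) with hw
  have hle : ‖w‖ ^ 2 ≤ ∑ k, ‖(m k).adjoint w‖ * ‖v k‖ :=
    calc ‖w‖ ^ 2 = ∑ k, RCLike.re ⟪(m k).adjoint w, v k⟫_ℂ := by
          simp only [adjoint_inner_left, ← map_sum, ← inner_sum, ← hw, inner_self_eq_norm_sq]
      _ ≤ _ := Finset.sum_le_sum fun k _ => re_inner_le_norm _ _
  have hamgm : 2 * ∑ k, ‖(m k).adjoint w‖ * ‖v k‖ ≤
      ∑ k, ‖(m k).adjoint w‖ ^ 2 + ∑ k, ‖v k‖ ^ 2 := by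
    rw [Finset.mul_sum, ← Finset.sum_add_distrib]
    exact Finset.sum_le_sum fun k _ => by linarith [two_mul_le_add_sq ‖(m k).adjoint w‖ ‖v k‖]
  linarith [hm w]

end SumMulAdjoint

/-- A finite family `m₁, …, mₙ` in `M` for which the row operator `(m₁, …, mₙ) : Hⁿ → K` is a
contraction; the bound is stated for its adjoint column. -/
structure ContractiveRow (M : Submodule ℂ (H →L[ℂ] K)) where
  size : ℕ
  op : Fin size → M
  sum_norm_adjoint_sq_le : ∀ y, ∑ k, ‖(op k : H →L[ℂ] K).adjoint y‖ ^ 2 ≤ ‖y‖ ^ 2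

variable {M : Submodule ℂ (H →L[ℂ] K)}

/-- The positive contraction `∑ mₖ mₖ*` of a contractive row. -/
def ContractiveRow.unit (r : ContractiveRow M) : K →L[ℂ] K :=
  sumMulAdjoint fun k => (r.op k : H →L[ℂ] K)

theorem ContractiveRow.norm_unit_le (r : ContractiveRow M) : ‖r.unit‖ ≤ 1 :=
  opNorm_le_bound _ zero_le_one fun y => by
    refine le_of_sq_le_sq ?_ (by positivity)
    rw [one_mul, ContractiveRow.unit, sumMulAdjoint_apply]
    exact (norm_sum_apply_sq_le r.sum_norm_adjoint_sq_le _).trans (r.sum_norm_adjoint_sq_le y)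

omit [CompleteSpace H] [CompleteSpace K] in
theorem aeval_comp_mem {a : K →L[ℂ] K} (ha : ∀ m ∈ M, a ∘L m ∈ M) (p : ℝ[X]) {m : H →L[ℂ] K}
    (hm : m ∈ M) : aeval a p ∘L m ∈ M := by
  induction p using Polynomial.induction_on with
  | C r =>
    have : aeval a (C r) ∘L m = (r : ℂ) • m := by ext; simp [Algebra.algebraMap_eq_smul_one]
    exact this ▸ M.smul_mem _ hm
  | add p q hp hq =>
    rw [map_add, ContinuousLinearMap.add_comp]
    exact M.add_mem hp hq
  | monomial n r ih =>
    have : aeval a (C r * X ^ (n + 1)) ∘L m = a ∘L aeval a (C r * X ^ n) ∘L m := by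
      rw [pow_succ', mul_left_comm, map_mul, aeval_X]; rfl
    exact this ▸ ha _ ih

/-- A contractive row with an arbitrary finite index type, renumbered. -/
def ContractiveRow.ofFintype {ι : Type*} [Fintype ι] (m : ι → M)
    (hm : ∀ y, ∑ j, ‖(m j : H →L[ℂ] K).adjoint y‖ ^ 2 ≤ ‖y‖ ^ 2) : ContractiveRow M where
  size := Fintype.card ι
  op k := m ((Fintype.equivFin ι).symm k)
  sum_norm_adjoint_sq_le y :=
    ((Fintype.equivFin ι).symm.sum_comp fun j => ‖(m j : H →L[ℂ] K).adjoint y‖ ^ 2).trans_le (hm y)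

theorem ContractiveRow.unit_ofFintype {ι : Type*} [Fintype ι] (m : ι → M)
    (hm : ∀ y, ∑ j, ‖(m j : H →L[ℂ] K).adjoint y‖ ^ 2 ≤ ‖y‖ ^ 2) :
    (ContractiveRow.ofFintype m hm).unit = sumMulAdjoint fun j => (m j : H →L[ℂ] K) :=
  (Fintype.equivFin ι).symm.sum_comp fun j => (m j : H →L[ℂ] K) ∘L (m j : H →L[ℂ] K).adjoint

/-- A net of contractive rows is an approximate unit of `M` when the operators `∑ mₖ mₖ*` converge
to a left unit of `M` in norm. -/
def IsApproxUnit {ι : Type*} (r : ι → ContractiveRow M) (l : Filter ι) : Prop :=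
  ∀ m : M, Tendsto (fun i => (r i).unit ∘L (m : H →L[ℂ] K)) l (𝓝 m)

theorem tendsto_apply_of_dense_span {E F ι : Type*} [NormedAddCommGroup E] [NormedSpace ℂ E]
    [NormedAddCommGroup F] [NormedSpace ℂ F] {l : Filter ι} {f : ι → E →L[ℂ] F} {C : ℝ}
    (hf : ∀ i, ‖f i‖ ≤ C) (g : E →L[ℂ] F) {s : Set E}
    (hs : Dense (Submodule.span ℂ s : Set E)) (hfg : ∀ x ∈ s, Tendsto (f · x) l (𝓝 (g x))) (x : E) :
    Tendsto (f · x) l (𝓝 (g x)) := by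
  have heq : Equicontinuous fun i => ⇑(f i) :=
    (show (∃ C, ∀ i, ‖f i‖ ≤ C) ↔ _ from (NormedSpace.equicontinuous_TFAE f).out 5 1).1 ⟨C, hf⟩
  refine closure_minimal (fun x hx => ?_) (heq.isClosed_setOfPred_tendsto g.continuous) (hs x)
  induction hx using Submodule.span_induction with
  | mem x hx => exact hfg x hx
  | zero => simpa using tendsto_const_nhds
  | add x y _ _ hx hy => simpa using hx.add hy
  | smul a x _ hx => simpa using hx.const_smul a

theorem IsApproxUnit.tendsto_apply {ι : Type*} {l : Filter ι} {r : ι → ContractiveRow M}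
    (hr : IsApproxUnit r l)
    (hd : Dense (Submodule.span ℂ (Set.range fun p : M × H => (p.1 : H →L[ℂ] K) p.2) : Set K))
    (y : K) : Tendsto (fun i => (r i).unit y) l (𝓝 y) := by
  refine tendsto_apply_of_dense_span (fun i => (r i).norm_unit_le) (.id ℂ K) hd ?_ y
  rintro _ ⟨⟨m, x⟩, rfl⟩
  have heval : Continuous fun T : H →L[ℂ] K => T x := by fun_prop
  exact (heval.tendsto _).comp (hr m)

theorem tendsto_wstar_of_tendsto_apply {E F ι : Type*} [NormedAddCommGroup E]
    [InnerProductSpace ℂ E] [NormedAddCommGroup F] [InnerProductSpace ℂ F] {l : Filter ι}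
    {f : ι → E →L[ℂ] F} {g : E →L[ℂ] F} {C : ℝ} (hf : ∀ i, ‖f i‖ ≤ C)
    (hfg : ∀ y, Tendsto (f · y) l (𝓝 (g y))) :
    Tendsto f l (@nhds _ (wstarTopology E F) g) := by
  rw [nhds_induced, tendsto_comap_iff, tendsto_pi_nhds]
  intro p
  refine tendsto_tsum_of_dominated_convergence (p.summable_norm_mul_norm.mul_left C)
    (fun n => tendsto_const_nhds.inner (hfg _)) (.of_forall fun i n => ?_)
  calc ‖⟪p.1.2 n, f i (p.1.1 n)⟫_ℂ‖ ≤ ‖p.1.2 n‖ * (C * ‖p.1.1 n‖) :=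
        (norm_inner_le_norm _ _).trans (by gcongr; exact (f i).le_of_opNorm_le (hf i) _)
    _ = C * (‖p.1.1 n‖ * ‖p.1.2 n‖) := by ring

end ApproximateUnit

section TROApproximateUnit

open Polynomial Filter ContinuousLinearMap

variable {H K : Type u} [NormedAddCommGroup H] [InnerProductSpace ℂ H] [CompleteSpace H]
  [NormedAddCommGroup K] [InnerProductSpace ℂ K] [CompleteSpace K] {M : Submodule ℂ (H →L[ℂ] K)}

theorem exists_contractiveRow_norm_le (hM : IsTRO M)
    {ι : Type*} [Finite ι] (n : ι → M) {ε : ℝ} (hε : 0 < ε) :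
    ∃ r : ContractiveRow M, ∀ j, ‖(1 - r.unit) ∘L (n j : H →L[ℂ] K)‖ ≤ ε := by
  have := Fintype.ofFinite ι
  let n' (j : ι) : H →L[ℂ] K := n j
  have hmem (m) (hm : m ∈ M) : sumMulAdjoint n' ∘L m ∈ M := by
    rw [sumMulAdjoint, finsetSum_comp]
    exact M.sum_mem fun j _ => hM _ (n j).2 _ (n j).2 _ hm
  have hadj (q : ℝ[X]) := adjoint_aeval (.of_nonneg (sumMulAdjoint_nonneg n')) q
  obtain ⟨p, hp⟩ := exists_polynomial_near_inv_sqrt ‖sumMulAdjoint n'‖ (pow_pos hε 2)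
  have hrow (y : K) : ∑ j, ‖(aeval (sumMulAdjoint n') p ∘L n' j).adjoint y‖ ^ 2 ≤ ‖y‖ ^ 2 := by
    simp only [adjoint_comp, hadj, comp_apply]
    simpa using sum_norm_adjoint_aeval_sq_le n' zero_le_one (fun t ht => (hp t ht).1) y
  refine ⟨.ofFintype (fun j => ⟨_, aeval_comp_mem hmem p (n j).2⟩) hrow, fun j => ?_⟩
  have hunit : 1 - sumMulAdjoint (fun j => aeval (sumMulAdjoint n') p ∘L n' j) =
      aeval (sumMulAdjoint n') (1 - X * p ^ 2) := by
    rw [sumMulAdjoint_aeval_comp, map_sub, map_one]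
  have hj (y : K) : ‖(n' j).adjoint (aeval (sumMulAdjoint n') (1 - X * p ^ 2) y)‖ ^ 2 ≤
      ε ^ 2 * ‖y‖ ^ 2 :=
    (Finset.single_le_sum (fun k _ => by positivity) (Finset.mem_univ j)).trans
      (sum_norm_adjoint_aeval_sq_le n' (by positivity) (fun t ht => by simpa using (hp t ht).2) y)
  rw [ContractiveRow.unit_ofFintype, hunit, ← LinearIsometryEquiv.norm_map adjoint, adjoint_comp,
    hadj]
  refine opNorm_le_bound _ hε.le fun y => le_of_sq_le_sq ?_ (by positivity)
  rw [mul_pow]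
  exact hj y

theorem exists_isApproxUnit (hM : IsTRO M) :
    ∃ r : Finset M × ℕ → ContractiveRow M, IsApproxUnit r (atTop ×ˢ atTop) := by
  choose r hr using fun i : Finset M × ℕ =>
    exists_contractiveRow_norm_le hM (fun m : i.1 => m.1) (Nat.one_div_pos_of_nat (n := i.2))
  refine ⟨r, fun m => ?_⟩
  have hle : ∀ᶠ i in atTop ×ˢ atTop,
      ‖(r i).unit ∘L (m : H →L[ℂ] K) - m‖ ≤ 1 / (i.2 + 1 : ℝ) := by
    filter_upwards [tendsto_fst.eventually (eventually_ge_atTop {m})] with i hi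
    rw [← norm_neg, neg_sub]
    exact hr i ⟨m, hi (Finset.mem_singleton_self m)⟩
  refine tendsto_iff_norm_sub_tendsto_zero.2
    (squeeze_zero' (.of_forall fun _ => norm_nonneg _) hle ?_)
  exact tendsto_one_div_add_atTop_nhds_zero_nat.comp tendsto_snd

end TROApproximateUnit

section RectangularMatrices

variable {ι κ : Type*} [Fintype ι] [Fintype κ]

theorem norm_opMatrix_sumElim_sq {A E : Type*} [Zero A] [NormedAddCommGroup E] [NormedSpace ℂ E]
    {n : ℕ} (e : ι ⊕ κ ≃ Fin n) (Y : ι → κ → A) (φ : A → E →L[ℂ] E) (hφ : φ 0 = 0)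
    (v : PiLp 2 fun _ : Fin n => E) :
    ‖opMatrix (Matrix.map (Matrix.of fun a b => Sum.elim (fun i => Sum.elim (fun _ => 0) (Y i))
      (fun _ _ => 0) (e.symm a) (e.symm b)) φ) v‖ ^ 2 =
      ∑ i, ‖∑ j, φ (Y i j) (v (e (Sum.inr j)))‖ ^ 2 := by
  simp only [PiLp.norm_sq_eq_of_L2, ← e.sum_comp, Fintype.sum_sum_type, opMatrix_apply,
    Matrix.map_apply, Matrix.of_apply, Equiv.symm_apply_apply, Sum.elim_inl, Sum.elim_inr, hφ,
    zero_apply, Finset.sum_const_zero, norm_zero, zero_pow two_ne_zero,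
    add_zero, zero_add]

theorem NormalRep.sum_norm_sq_le {H₀ : Type u} [NormedAddCommGroup H₀] [InnerProductSpace ℂ H₀]
    [CompleteSpace H₀] {A : Subalgebra ℂ (H₀ →L[ℂ] H₀)} (X : NormalRep A) (Y : ι → κ → A) {c : ℝ}
    (hc : 0 ≤ c)
    (hY : ∀ v : κ → H₀, ∑ i, ‖∑ j, (Y i j : H₀ →L[ℂ] H₀) (v j)‖ ^ 2 ≤ c ^ 2 * ∑ j, ‖v j‖ ^ 2)
    (w : κ → X.carrier) :
    ∑ i, ‖∑ j, X.rep (Y i j) (w j)‖ ^ 2 ≤ c ^ 2 * ∑ j, ‖w j‖ ^ 2 := by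
  -- Complete contractivity only speaks of square matrices, so `Y` is made a corner of one.
  let e := Fintype.equivFin (ι ⊕ κ)
  let Z : Matrix (Fin (Fintype.card (ι ⊕ κ))) (Fin (Fintype.card (ι ⊕ κ))) A :=
    Matrix.of fun a b => Sum.elim (fun i => Sum.elim (fun _ => 0) (Y i))
      (fun _ _ => 0) (e.symm a) (e.symm b)
  have norm_Z_le : ‖opMatrix (Z.map fun a => (a : H₀ →L[ℂ] H₀))‖ ≤ c := by
    refine ContinuousLinearMap.opNorm_le_bound _ hc fun v => le_of_sq_le_sq ?_ (by positivity)
    rw [norm_opMatrix_sumElim_sq e Y (fun a => (a : H₀ →L[ℂ] H₀)) rfl v, mul_pow,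
      PiLp.norm_sq_eq_of_L2, ← e.sum_comp, Fintype.sum_sum_type]
    exact (hY _).trans (by gcongr; exact le_add_of_nonneg_left (by positivity))
  have norm_rep_Z_le := pow_le_pow_left₀ (norm_nonneg _)
    ((opMatrix (Z.map fun a => X.rep a)).le_of_opNorm_le
      ((X.completelyContractive _ Z).trans norm_Z_le)
      (WithLp.toLp 2 fun a => Sum.elim (fun _ => 0) w (e.symm a))) 2
  rw [norm_opMatrix_sumElim_sq e Y (fun a => X.rep a) (map_zero _), mul_pow,
    PiLp.norm_sq_eq_of_L2, ← e.sum_comp, Fintype.sum_sum_type] at norm_rep_Z_le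
  simpa using norm_rep_Z_le

end RectangularMatrices

section WeakLimits

open Filter

theorem eventually_lt_norm_of_tendsto_inner {E ι : Type*} [NormedAddCommGroup E]
    [InnerProductSpace ℂ E] {l : Filter ι} {w : ι → E} {v : E}
    (hw : Tendsto (fun i => ⟪v, w i⟫_ℂ) l (𝓝 ⟪v, v⟫_ℂ)) {c : ℝ} (hc : c < ‖v‖) :
    ∀ᶠ i in l, c < ‖w i‖ := by
  rcases lt_or_ge c 0 with hneg | hnonneg
  · exact .of_forall fun i => hneg.trans_le (norm_nonneg _)
  have hv : 0 < ‖v‖ := hnonneg.trans_lt hc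
  have hlim : Tendsto (fun i => ‖⟪v, w i⟫_ℂ‖) l (𝓝 (‖v‖ * ‖v‖)) := by
    simpa [inner_self_eq_norm_sq_to_K, sq] using hw.norm
  filter_upwards [hlim.eventually (lt_mem_nhds (mul_lt_mul_of_pos_left hc hv))] with i hi
  exact lt_of_mul_lt_mul_left (hi.trans_le (norm_inner_le_norm _ _)) hv.le

theorem norm_le_of_tendsto_inner {E ι : Type*} [NormedAddCommGroup E] [InnerProductSpace ℂ E]
    {l : Filter ι} [l.NeBot] {w : ι → E} {v : E}
    (hw : Tendsto (fun i => ⟪v, w i⟫_ℂ) l (𝓝 ⟪v, v⟫_ℂ)) {C : ℝ} (hC : ∀ i, ‖w i‖ ≤ C) :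
    ‖v‖ ≤ C :=
  le_of_forall_lt fun _ hc =>
    let ⟨i, hi⟩ := (eventually_lt_norm_of_tendsto_inner hw hc).exists
    hi.trans_le (hC i)

end WeakLimits

section Bimodules

open Filter ContinuousLinearMap

variable {H₀ K₀ : Type u}
  [NormedAddCommGroup H₀] [InnerProductSpace ℂ H₀] [CompleteSpace H₀]
  [NormedAddCommGroup K₀] [InnerProductSpace ℂ K₀] [CompleteSpace K₀]
  {A : Subalgebra ℂ (H₀ →L[ℂ] H₀)} {B : Subalgebra ℂ (K₀ →L[ℂ] K₀)}
  {M : Submodule ℂ (H₀ →L[ℂ] K₀)}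

/-- An element of `M`, as an element of `U`. -/
def toU (m : M) : bimodU B M := ⟨m, mem_bimodU m.2⟩

/-- The adjoint of an element of `M`, as an element of `V`. -/
def adjV (m : M) : bimodV B M :=
  ⟨(m : H₀ →L[ℂ] K₀).adjoint, subset_wstarSpan _ ⟨m, m.2, 1, B.one_mem, rfl⟩⟩

/-- The product `S b`, for `S ∈ V` and `b ∈ B`, as an element of `V`. -/
def mulV (S : bimodV B M) (b : B) : bimodV B M :=
  ⟨(S : K₀ →L[ℂ] H₀) ∘L (b : K₀ →L[ℂ] K₀), comp_mem_bimodV b.2 S.2⟩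

/-- The product `S T`, for `S ∈ V` and `T ∈ U`, as an element of `A`. -/
def IsTROEquivalence.mulVU (h : IsTROEquivalence A B M) (S : bimodV B M) (T : bimodU B M) : A :=
  ⟨(S : K₀ →L[ℂ] H₀) ∘L (T : H₀ →L[ℂ] K₀), h.comp_mem S.2 T.2⟩

theorem IsTROEquivalence.star_mulVU_adjV_toU (h : IsTROEquivalence A B M) (m n : M) :
    star (h.mulVU (adjV m) (toU n) : H₀ →L[ℂ] H₀) = h.mulVU (adjV n) (toU m) := by
  simp only [mulVU, adjV, toU, star_eq_adjoint, adjoint_comp, adjoint_adjoint]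

theorem NormalRep.adjoint_rep_mulVU_adjV_toU (h : IsTROEquivalence A B M) (X : NormalRep A)
    (m n : M) : (X.rep (h.mulVU (adjV m) (toU n))).adjoint = X.rep (h.mulVU (adjV n) (toU m)) := by
  have hmem : star (h.mulVU (adjV m) (toU n) : H₀ →L[ℂ] H₀) ∈ A := by
    rw [h.star_mulVU_adjV_toU]
    exact (h.mulVU (adjV n) (toU m)).2
  rw [← star_eq_adjoint, ← X.rep_star _ hmem]
  exact congrArg X.rep (Subtype.ext (h.star_mulVU_adjV_toU m n))

theorem IsTROEquivalence.comp_adjoint_mem (h : IsTROEquivalence A B M) (m n : M) :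
    (m : H₀ →L[ℂ] K₀) ∘L (n : H₀ →L[ℂ] K₀).adjoint ∈ B := by
  rw [← Subalgebra.mem_toSubmodule, h.right_eq]
  exact subset_wstarSpan _ ⟨m, m.2, 1, A.one_mem, n, n.2, rfl⟩

theorem IsTROEquivalence.isClosed_right (h : IsTROEquivalence A B M) :
    IsClosed[wstarTopology K₀ K₀] (B : Set (K₀ →L[ℂ] K₀)) := by
  rw [← Subalgebra.coe_toSubmodule, h.right_eq]
  exact isClosed_wstarSpan _

theorem IsTROEquivalence.dense_span_range (h : IsTROEquivalence A B M) :
    Dense (Submodule.span ℂ (Set.range fun p : M × H₀ => (p.1 : H₀ →L[ℂ] K₀) p.2) : Set K₀) := by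
  rw [Submodule.dense_iff_topologicalClosure_eq_top, Submodule.topologicalClosure_eq_top_iff,
    Submodule.eq_bot_iff]
  intro y hy
  -- `1 ∈ [M A M*]`, so a vector orthogonal to `M H₀` is orthogonal to itself.
  have hclosed : IsClosed[wstarTopology K₀ K₀]
      ((vecFunctional y y).toLinearMap.ker : Set (K₀ →L[ℂ] K₀)) := by
    let : TopologicalSpace (K₀ →L[ℂ] K₀) := wstarTopology K₀ K₀
    exact isClosed_singleton.preimage (wstar_continuous_inner y y)
  have hone : (1 : K₀ →L[ℂ] K₀) ∈ (Subalgebra.toSubmodule B) := B.one_mem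
  rw [h.right_eq] at hone
  refine inner_self_eq_zero.1 (map_mem_of_mem_wstarSpan hclosed LinearMap.id
    (@continuous_id _ (wstarTopology K₀ K₀)) ?_ hone)
  rintro _ ⟨m, hm, a, -, n, -, rfl⟩
  exact Submodule.inner_left_of_mem_orthogonal
    (Submodule.subset_span (Set.mem_range_self (⟨⟨m, hm⟩, a (n.adjoint y)⟩ : M × H₀))) hy

/-- The positive contraction `∑ mₖ mₖ*` of a contractive row, as an element of `B`. -/
def ContractiveRow.unitB (r : ContractiveRow M) (h : IsTROEquivalence A B M) : B :=
  ⟨r.unit, B.sum_mem (t := Finset.univ) fun k _ => h.comp_adjoint_mem (r.op k) (r.op k)⟩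

theorem IsApproxUnit.tendsto_unitB {ι : Type*} {l : Filter ι} {r : ι → ContractiveRow M}
    (hr : IsApproxUnit r l) (h : IsTROEquivalence A B M) :
    Tendsto (fun i => (r i).unitB h) l
      (@nhds _ (TopologicalSpace.induced Subtype.val (wstarTopology K₀ K₀)) (1 : B)) := by
  let : TopologicalSpace (K₀ →L[ℂ] K₀) := wstarTopology K₀ K₀
  rw [nhds_induced, tendsto_comap_iff]
  exact tendsto_wstar_of_tendsto_apply (fun i => (r i).norm_unit_le)
    (hr.tendsto_apply h.dense_span_range)

theorem continuous_inner_rep_mulVU (h : IsTROEquivalence A B M) (X : NormalRep A) (S : bimodV B M)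
    (T : bimodU B M) (x y : X.carrier) :
    Continuous[TopologicalSpace.induced Subtype.val (wstarTopology K₀ K₀), inferInstance]
      fun b : B => ⟪y, X.rep (h.mulVU S (mulU b T)) x⟫_ℂ := by
  let : TopologicalSpace (K₀ →L[ℂ] K₀) := wstarTopology K₀ K₀
  let : TopologicalSpace (H₀ →L[ℂ] K₀) := wstarTopology H₀ K₀
  let : TopologicalSpace (H₀ →L[ℂ] H₀) := wstarTopology H₀ H₀
  let : TopologicalSpace (X.carrier →L[ℂ] X.carrier) := wstarTopology X.carrier X.carrier
  let : TopologicalSpace A := TopologicalSpace.induced Subtype.val (wstarTopology H₀ H₀)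
  let : TopologicalSpace B := TopologicalSpace.induced Subtype.val (wstarTopology K₀ K₀)
  have hval : Continuous fun b : B => (b : K₀ →L[ℂ] K₀) := continuous_induced_dom
  have hmul : Continuous fun b : B => h.mulVU S (mulU b T) :=
    continuous_induced_rng.2 ((wstar_continuous_comp_left (S : K₀ →L[ℂ] H₀)).comp
      ((wstar_continuous_comp_right (T : H₀ →L[ℂ] K₀)).comp hval))
  exact (wstar_continuous_inner x y).comp (X.wstarContinuous.comp hmul)

end Bimodules

/-! ### The Hilbert space `F_U(H)` -/

section Evaluation

open ContinuousLinearMap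

variable {H₀ K₀ : Type u}
  [NormedAddCommGroup H₀] [InnerProductSpace ℂ H₀] [CompleteSpace H₀]
  [NormedAddCommGroup K₀] [InnerProductSpace ℂ K₀] [CompleteSpace K₀]
  {A : Subalgebra ℂ (H₀ →L[ℂ] H₀)} {B : Subalgebra ℂ (K₀ →L[ℂ] K₀)}
  {M : Submodule ℂ (H₀ →L[ℂ] K₀)} (h : IsTROEquivalence A B M) (X : NormalRep A)

theorem FUSpace.dense_span_range_tmul :
    Dense (Submodule.span ℂ (Set.range fun p : bimodU B M × X.carrier =>
      FUSpace.tmul h X p.1 p.2) : Set (FUSpace h X)) := by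
  refine UniformSpace.Completion.denseRange_coe.mono ?_
  rintro _ ⟨z, rfl⟩
  change (bimodU B M) ⊗[ℂ] X.carrier at z
  let coe : (bimodU B M) ⊗[ℂ] X.carrier →ₗ[ℂ] FUSpace h X :=
    (UniformSpace.Completion.toComplL (𝕜 := ℂ) (E := PreFU h X)).toLinearMap
  change coe z ∈ _
  induction z using TensorProduct.induction_on with
  | zero => rw [map_zero]; exact Submodule.zero_mem _
  | tmul T x => exact Submodule.subset_span ⟨(T, x), rfl⟩
  | add z w hz hw => rw [map_add]; exact Submodule.add_mem _ hz hw

/-- The operator `T ⊗ x ↦ α(S T) x` from `F_U(H)` to `H`, for `S ∈ V`. -/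
def evalV (S : bimodV B M) : FUSpace h X →L[ℂ] X.carrier :=
  fromCompletion (α := PreFU h X) <| LinearMap.mkContinuous
    (show (bimodU B M) ⊗[ℂ] X.carrier →ₗ[ℂ] X.carrier from
      PiLp.projₗ (𝕜 := ℂ) 2 (fun _ : Fin 1 => X.carrier) 0 ∘ₗ colEval h X fun _ => S)
    ‖colOp fun _ : Fin 1 => (S : K₀ →L[ℂ] H₀)‖
    fun z => (PiLp.norm_apply_le _ _).trans (colEval_le h X (fun _ : Fin 1 => S) z)

theorem evalV_coe {n : ℕ} (S : Fin n → bimodV B M) (k : Fin n) (z : PreFU h X) :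
    evalV h X (S k) (z : FUSpace h X) = colEval h X S z k := by
  refine (fromCompletion_apply_coe _ z).trans ?_
  change (bimodU B M) ⊗[ℂ] X.carrier at z
  have heq : PiLp.projₗ (𝕜 := ℂ) 2 (fun _ : Fin 1 => X.carrier) 0 ∘ₗ colEval h X (fun _ => S k) =
      PiLp.projₗ (𝕜 := ℂ) 2 (fun _ : Fin n => X.carrier) k ∘ₗ colEval h X S :=
    TensorProduct.ext' fun T x =>
      (colEval_tmul h X (fun _ : Fin 1 => S k) T x 0).trans (colEval_tmul h X S T x k).symm
  exact LinearMap.congr_fun heq z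

theorem evalV_tmul (S : bimodV B M) (T : bimodU B M) (x : X.carrier) :
    evalV h X S (FUSpace.tmul h X T x) = X.rep (h.mulVU S T) x :=
  (evalV_coe h X (fun _ : Fin 1 => S) 0 _).trans (colEval_tmul h X (fun _ : Fin 1 => S) T x 0)

theorem evalV_actCLM (S : bimodV B M) (b : B) (z : FUSpace h X) :
    evalV h X S (actCLM h X b z) = evalV h X (mulV S b) z := by
  have heq : evalV h X S ∘L actCLM h X b = evalV h X (mulV S b) :=
    FUSpace.hom_ext fun T x => by
      rw [comp_apply, actCLM_tmul, evalV_tmul, evalV_tmul]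
      rfl
  exact DFunLike.congr_fun heq z

theorem evalV_actCLM_unitB (S : bimodV B M) (r : ContractiveRow M) (z : FUSpace h X) :
    evalV h X S (actCLM h X (r.unitB h) z) =
      ∑ k, X.rep (h.mulVU S (toU (r.op k))) (evalV h X (adjV (r.op k)) z) := by
  have heq : evalV h X S ∘L actCLM h X (r.unitB h) =
      ∑ k, X.rep (h.mulVU S (toU (r.op k))) ∘L evalV h X (adjV (r.op k)) :=
    FUSpace.hom_ext fun T x => by
      have hprod : h.mulVU S (mulU (r.unitB h) T) =
          ∑ k, h.mulVU S (toU (r.op k)) * h.mulVU (adjV (r.op k)) T := by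
        ext v
        simp only [AddSubmonoidClass.coe_finsetSum, sum_apply]
        exact (congrArg (S : K₀ →L[ℂ] H₀) (sumMulAdjoint_apply _ _)).trans
          (map_sum (S : K₀ →L[ℂ] H₀) _ _)
      simp only [comp_apply, sum_apply, actCLM_tmul, evalV_tmul, hprod, map_sum, map_mul,
        mul_apply_eq_comp]
  simpa using DFunLike.congr_fun heq z

theorem norm_actCLM_le (b : B) : ‖actCLM h X b‖ ≤ ‖(b : K₀ →L[ℂ] K₀)‖ := by
  refine opNorm_le_bound _ (norm_nonneg _) fun z => ?_
  induction z using UniformSpace.Completion.induction_on with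
  | hp => exact isClosed_le (by fun_prop) (by fun_prop)
  | ih z =>
    rw [actCLM, completion_apply_coe, UniformSpace.Completion.norm_coe,
      UniformSpace.Completion.norm_coe]
    exact (preAct h X b).le_of_opNorm_le (LinearMap.mkContinuous_norm_le _ (norm_nonneg _) _) z

/-- The column `T ⊗ x ↦ (α(mₖ* T) x)ₖ` of a contractive row. -/
def colMap (r : ContractiveRow M) : FUSpace h X →ₗ[ℂ] PiLp 2 fun _ : Fin r.size => X.carrier where
  toFun z := WithLp.toLp 2 fun k => evalV h X (adjV (r.op k)) z
  map_add' z w := by ext k; simp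
  map_smul' a z := by ext k; simp

theorem norm_colMap_sq (r : ContractiveRow M) (z : FUSpace h X) :
    ‖colMap h X r z‖ ^ 2 = ∑ k, ‖evalV h X (adjV (r.op k)) z‖ ^ 2 :=
  PiLp.norm_sq_eq_of_L2 _ _

theorem norm_colMap_le (r : ContractiveRow M) (z : FUSpace h X) : ‖colMap h X r z‖ ≤ ‖z‖ := by
  have hcol : ‖colOp fun k => (r.op k : H₀ →L[ℂ] K₀).adjoint‖ ≤ 1 := by
    refine opNorm_le_bound _ zero_le_one fun v => le_of_sq_le_sq ?_ (by positivity)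
    simpa [PiLp.norm_sq_eq_of_L2, colOp, opMatrix_apply] using r.sum_norm_adjoint_sq_le (v 0)
  refine le_of_sq_le_sq ?_ (norm_nonneg _)
  rw [norm_colMap_sq]
  induction z using UniformSpace.Completion.induction_on with
  | hp => exact isClosed_le (by fun_prop) (by fun_prop)
  | ih z =>
    simp only [evalV_coe h X fun k => adjV (r.op k)]
    rw [← PiLp.norm_sq_eq_of_L2, UniformSpace.Completion.norm_coe]
    exact pow_le_pow_left₀ (norm_nonneg _)
      (le_supNorm h X ⟨r.size, fun k => adjV (r.op k), hcol⟩ z) 2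

end Evaluation

section Norm

open Filter ContinuousLinearMap

variable {H₀ K₀ : Type u}
  [NormedAddCommGroup H₀] [InnerProductSpace ℂ H₀] [CompleteSpace H₀]
  [NormedAddCommGroup K₀] [InnerProductSpace ℂ K₀] [CompleteSpace K₀]
  {A : Subalgebra ℂ (H₀ →L[ℂ] H₀)} {B : Subalgebra ℂ (K₀ →L[ℂ] K₀)}
  {M : Submodule ℂ (H₀ →L[ℂ] K₀)} (h : IsTROEquivalence A B M) (X : NormalRep A)
  {ι κ : Type*} [Fintype ι] [Fintype κ]
  {N : Type*} {l : Filter N} {r : N → ContractiveRow M}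

/-- The action of a rectangular matrix over `V` on columns over `F_U(H)`, with values in the
columns over `H`. -/
def evalMatrix (S : ι → κ → bimodV B M) (v : κ → FUSpace h X) : PiLp 2 fun _ : ι => X.carrier :=
  WithLp.toLp 2 fun i => ∑ j, evalV h X (S i j) (v j)

theorem norm_evalMatrix_unitB_sq_le {S : ι → κ → bimodV B M} {c : ℝ} (hc : 0 ≤ c)
    (hS : ∀ u : κ → K₀, ∑ i, ‖∑ j, (S i j : K₀ →L[ℂ] H₀) (u j)‖ ^ 2 ≤ c ^ 2 * ∑ j, ‖u j‖ ^ 2)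
    (r : ContractiveRow M) (v : κ → FUSpace h X) :
    ‖evalMatrix h X S fun j => actCLM h X (r.unitB h) (v j)‖ ^ 2 ≤
      c ^ 2 * ∑ j, ‖colMap h X r (v j)‖ ^ 2 := by
  simp only [norm_colMap_sq, evalMatrix, evalV_actCLM_unitB]
  rw [PiLp.norm_sq_eq_of_L2]
  simp only [← Fintype.sum_prod_type']
  refine X.sum_norm_sq_le (fun i (p : κ × Fin r.size) => h.mulVU (S i p.1) (toU (r.op p.2))) hc
    (fun u => ?_) fun p => evalV h X (adjV (r.op p.2)) (v p.1)
  calc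
    _ = ∑ i, ‖∑ j, (S i j : K₀ →L[ℂ] H₀) (∑ k, (r.op k : H₀ →L[ℂ] K₀) (u (j, k)))‖ ^ 2 := by
      simp only [Fintype.sum_prod_type, map_sum]
      rfl
    _ ≤ c ^ 2 * ∑ j, ‖∑ k, (r.op k : H₀ →L[ℂ] K₀) (u (j, k))‖ ^ 2 := hS _
    _ ≤ c ^ 2 * ∑ p, ‖u p‖ ^ 2 := by
      rw [Fintype.sum_prod_type]
      gcongr
      exact norm_sum_apply_sq_le r.sum_norm_adjoint_sq_le _

theorem tendsto_inner_evalV_unitB (hr : IsApproxUnit r l) (S : bimodV B M) (y : X.carrier)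
    (z : FUSpace h X) :
    Tendsto (fun i => ⟪y, evalV h X S (actCLM h X ((r i).unitB h) z)⟫_ℂ) l
      (𝓝 ⟪y, evalV h X S z⟫_ℂ) := by
  refine tendsto_apply_of_dense_span
    (f := fun i => innerSL ℂ y ∘L evalV h X S ∘L actCLM h X ((r i).unitB h))
    (g := innerSL ℂ y ∘L evalV h X S) (C := ‖innerSL ℂ y‖ * (‖evalV h X S‖ * 1)) (fun i => ?_)
    (FUSpace.dense_span_range_tmul h X) ?_ z
  · refine (opNorm_comp_le _ _).trans ?_
    gcongr
    refine (opNorm_comp_le _ _).trans ?_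
    gcongr
    exact (norm_actCLM_le h X _).trans (r i).norm_unit_le
  · rintro _ ⟨⟨T, x⟩, rfl⟩
    let : TopologicalSpace B := TopologicalSpace.induced Subtype.val (wstarTopology K₀ K₀)
    have hlim := ((continuous_inner_rep_mulVU h X S T x y).tendsto 1).comp (hr.tendsto_unitB h)
    have hone : mulU (1 : B) T = T := rfl
    simpa [Function.comp_def, actCLM_tmul, evalV_tmul, hone] using hlim

theorem tendsto_inner_evalMatrix_unitB (hr : IsApproxUnit r l) (S : ι → κ → bimodV B M)
    (y : PiLp 2 fun _ : ι => X.carrier) (v : κ → FUSpace h X) :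
    Tendsto (fun i => ⟪y, evalMatrix h X S fun j => actCLM h X ((r i).unitB h) (v j)⟫_ℂ) l
      (𝓝 ⟪y, evalMatrix h X S v⟫_ℂ) := by
  simp only [evalMatrix, PiLp.inner_apply, inner_sum]
  exact tendsto_finsetSum _ fun i _ => tendsto_finsetSum _ fun j _ =>
    tendsto_inner_evalV_unitB h X hr (S i j) (y i) (v j)

theorem eventually_lt_norm_colMap (hr : IsApproxUnit r l) {n : ℕ} {S : Fin n → bimodV B M}
    (hS : ‖colOp fun i => (S i : K₀ →L[ℂ] H₀)‖ ≤ 1) (z : PreFU h X) {c : ℝ}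
    (hc : c < ‖colEval h X S z‖) : ∀ᶠ i in l, c < ‖colMap h X (r i) (z : FUSpace h X)‖ := by
  have heval : colEval h X S z = evalMatrix h X (fun i (_ : Unit) => S i) fun _ => z := by
    ext i
    simp [evalMatrix, evalV_coe]
  rw [heval] at hc
  filter_upwards [eventually_lt_norm_of_tendsto_inner
    (tendsto_inner_evalMatrix_unitB h X hr (fun i (_ : Unit) => S i) _ fun _ => z) hc] with i hi
  refine hi.trans_le (le_of_sq_le_sq ?_ (norm_nonneg _))
  refine (norm_evalMatrix_unitB_sq_le h X zero_le_one (fun u => ?_) (r i) fun _ => z).trans ?_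
  · have hcol := (norm_colOp_apply (fun i => (S i : K₀ →L[ℂ] H₀)) (u ())).trans
      (mul_le_of_le_one_left (norm_nonneg _) hS)
    simpa [PiLp.norm_sq_eq_of_L2] using pow_le_pow_left₀ (norm_nonneg _) hcol 2
  · simp

theorem tendsto_norm_colMap (hr : IsApproxUnit r l) (z : FUSpace h X) :
    Tendsto (fun i => ‖colMap h X (r i) z‖) l (𝓝 ‖z‖) := by
  induction z using UniformSpace.Completion.induction_on with
  | hp =>
    have hlip (i) : LipschitzWith 1 fun z => ‖colMap h X (r i) z‖ :=
      LipschitzWith.of_dist_le_mul fun z w => (dist_norm_norm_le _ _).trans <| by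
        simpa [dist_eq_norm] using norm_colMap_le h X (r i) (z - w)
    have heq : Equicontinuous fun i z => ‖colMap h X (r i) z‖ :=
      (LipschitzWith.uniformEquicontinuous _ 1 hlip).equicontinuous
    exact heq.isClosed_setOfPred_tendsto continuous_norm
  | ih z =>
    refine tendsto_order.2 ⟨fun c hc => ?_, fun c hc => .of_forall fun i =>
      (norm_colMap_le h X (r i) _).trans_lt hc⟩
    rw [UniformSpace.Completion.norm_coe] at hc
    obtain ⟨⟨n, S, hS⟩, hlt⟩ := exists_lt_of_lt_ciSup hc
    exact eventually_lt_norm_colMap h X hr hS z hlt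

theorem norm_evalMatrix_sq_le {S : ι → κ → bimodV B M} {c : ℝ} (hc : 0 ≤ c)
    (hS : ∀ u : κ → K₀, ∑ i, ‖∑ j, (S i j : K₀ →L[ℂ] H₀) (u j)‖ ^ 2 ≤ c ^ 2 * ∑ j, ‖u j‖ ^ 2)
    (v : κ → FUSpace h X) : ‖evalMatrix h X S v‖ ^ 2 ≤ c ^ 2 * ∑ j, ‖v j‖ ^ 2 := by
  obtain ⟨r, hr⟩ := exists_isApproxUnit h.isTRO
  refine (Real.le_sqrt (norm_nonneg _) (by positivity)).1 (norm_le_of_tendsto_inner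
    (tendsto_inner_evalMatrix_unitB h X hr S _ v) fun i => Real.le_sqrt_of_sq_le ?_)
  refine (norm_evalMatrix_unitB_sq_le h X hc hS (r i) v).trans ?_
  gcongr
  exact norm_colMap_le h X (r i) _

end Norm

section InnerProduct

open Filter ContinuousLinearMap

variable {H₀ K₀ : Type u}
  [NormedAddCommGroup H₀] [InnerProductSpace ℂ H₀] [CompleteSpace H₀]
  [NormedAddCommGroup K₀] [InnerProductSpace ℂ K₀] [CompleteSpace K₀]
  {A : Subalgebra ℂ (H₀ →L[ℂ] H₀)} {B : Subalgebra ℂ (K₀ →L[ℂ] K₀)}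
  {M : Submodule ℂ (H₀ →L[ℂ] K₀)} (h : IsTROEquivalence A B M) (X : NormalRep A)
  {N : Type*} {l : Filter N} {r : N → ContractiveRow M}

instance FUSpace.innerProductSpaceable : InnerProductSpaceable (FUSpace h X) where
  parallelogram_identity z w := by
    obtain ⟨r, hr⟩ := exists_isApproxUnit h.isTRO
    have hlim (z) := tendsto_norm_colMap h X hr z
    refine tendsto_nhds_unique (((hlim (z + w)).mul (hlim (z + w))).add
      ((hlim (z - w)).mul (hlim (z - w)))) ?_
    refine ((((hlim z).mul (hlim z)).add ((hlim w).mul (hlim w))).const_mul 2).congr fun i => ?_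
    rw [map_add, map_sub]
    exact (parallelogram_law_with_norm_mul ℂ _ _).symm

instance FUSpace.innerProductSpace : InnerProductSpace ℂ (FUSpace h X) :=
  InnerProductSpace.ofNorm ℂ (FUSpace.innerProductSpaceable h X).parallelogram_identity

theorem tendsto_inner_colMap (hr : IsApproxUnit r l) (z w : FUSpace h X) :
    Tendsto (fun i => ⟪colMap h X (r i) z, colMap h X (r i) w⟫_ℂ) l (𝓝 ⟪z, w⟫_ℂ) := by
  have hlim (z) : Tendsto (fun i => (‖colMap h X (r i) z‖ : ℂ) ^ 2) l (𝓝 ((‖z‖ : ℂ) ^ 2)) :=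
    ((Complex.continuous_ofReal.tendsto _).comp (tendsto_norm_colMap h X hr z)).pow 2
  simp only [inner_eq_sum_norm_sq_div_four, ← map_add, ← map_sub, ← map_smul]
  exact (((hlim _).sub (hlim _)).add (((hlim _).sub (hlim _)).mul_const _)).div_const 4

theorem inner_colMap_tmul_left (r : ContractiveRow M) (m : M) (x : X.carrier) (z : FUSpace h X) :
    ⟪colMap h X r (FUSpace.tmul h X (toU m) x), colMap h X r z⟫_ℂ =
      ⟪x, evalV h X (adjV m) (actCLM h X (r.unitB h) z)⟫_ℂ := by
  rw [evalV_actCLM_unitB, PiLp.inner_apply, inner_sum]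
  refine Finset.sum_congr rfl fun k _ => ?_
  rw [← X.adjoint_rep_mulVU_adjV_toU h, adjoint_inner_right, ← evalV_tmul]
  rfl

theorem inner_tmul_left (m : M) (x : X.carrier) (z : FUSpace h X) :
    ⟪FUSpace.tmul h X (toU m) x, z⟫_ℂ = ⟪x, evalV h X (adjV m) z⟫_ℂ := by
  obtain ⟨r, hr⟩ := exists_isApproxUnit h.isTRO
  refine tendsto_nhds_unique (tendsto_inner_colMap h X hr _ z) ?_
  simp only [inner_colMap_tmul_left]
  exact tendsto_inner_evalV_unitB h X hr _ x z

theorem FUSpace.ext_evalV {z w : FUSpace h X}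
    (hzw : ∀ m : M, evalV h X (adjV m) z = evalV h X (adjV m) w) : z = w := by
  obtain ⟨r, hr⟩ := exists_isApproxUnit h.isTRO
  have hcol (i) : colMap h X (r i) (z - w) = 0 := by
    ext k
    simp [colMap, hzw]
  have hlim := tendsto_norm_colMap h X hr (z - w)
  simp only [hcol, norm_zero] at hlim
  exact sub_eq_zero.1 (norm_eq_zero.1 (tendsto_nhds_unique hlim tendsto_const_nhds))

theorem FUSpace.dense_span_range_tmul_toU :
    Dense (Submodule.span ℂ (Set.range fun p : M × X.carrier =>
      FUSpace.tmul h X (toU p.1) p.2) : Set (FUSpace h X)) := by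
  rw [Submodule.dense_iff_topologicalClosure_eq_top, Submodule.topologicalClosure_eq_top_iff,
    Submodule.eq_bot_iff]
  intro z hz
  refine FUSpace.ext_evalV h X fun m => ext_inner_left ℂ fun x => ?_
  rw [← inner_tmul_left, map_zero, inner_zero_right]
  exact Submodule.inner_right_of_mem_orthogonal
    (Submodule.subset_span (Set.mem_range_self (m, x))) hz

theorem FUSpace.hom_ext_toU {E : Type*} [NormedAddCommGroup E] [NormedSpace ℂ E]
    {f g : FUSpace h X →L[ℂ] E}
    (hfg : ∀ (m : M) (x : X.carrier),
      f (FUSpace.tmul h X (toU m) x) = g (FUSpace.tmul h X (toU m) x)) : f = g :=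
  ext_on (FUSpace.dense_span_range_tmul_toU h X) (Set.forall_mem_range.2 fun p => hfg p.1 p.2)

theorem actRep_completelyContractive : IsCompletelyContractive (actRep h X) := by
  obtain ⟨r, hr⟩ := exists_isApproxUnit h.isTRO
  intro n b
  refine opNorm_le_bound _ (norm_nonneg _) fun v =>
    le_of_sq_le_sq ?_ (mul_nonneg (norm_nonneg _) (norm_nonneg _))
  set w := opMatrix (b.map fun a => actRep h X a) v with hw
  set c := ‖opMatrix (b.map fun a => (a : K₀ →L[ℂ] K₀))‖
  have hbound (r : ContractiveRow M) : ∑ i, ‖colMap h X r (w i)‖ ^ 2 ≤ c ^ 2 * ∑ j, ‖v j‖ ^ 2 := by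
    let S (p : Fin n × Fin r.size) (j : Fin n) : bimodV B M := mulV (adjV (r.op p.2)) (b p.1 j)
    have hcol : ∑ i, ‖colMap h X r (w i)‖ ^ 2 = ‖evalMatrix h X S v‖ ^ 2 := by
      simp only [norm_colMap_sq, evalMatrix]
      simp only [PiLp.norm_sq_eq_of_L2, Fintype.sum_prod_type, S, ← evalV_actCLM, ← map_sum, hw,
        opMatrix_apply]
      rfl
    rw [hcol]
    refine norm_evalMatrix_sq_le h X (norm_nonneg _) (fun u => ?_) v
    calc
      _ = ∑ i, ∑ k, ‖(r.op k : H₀ →L[ℂ] K₀).adjoint (∑ j, (b i j : K₀ →L[ℂ] K₀) (u j))‖ ^ 2 := by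
        simp only [Fintype.sum_prod_type, map_sum]
        rfl
      _ ≤ ∑ i, ‖∑ j, (b i j : K₀ →L[ℂ] K₀) (u j)‖ ^ 2 :=
        Finset.sum_le_sum fun i _ => r.sum_norm_adjoint_sq_le _
      _ ≤ c ^ 2 * ∑ j, ‖u j‖ ^ 2 := by
        have hop := (opMatrix (b.map fun a => (a : K₀ →L[ℂ] K₀))).le_opNorm (WithLp.toLp 2 u)
        have hsq := pow_le_pow_left₀ (norm_nonneg _) hop 2
        rw [mul_pow, PiLp.norm_sq_eq_of_L2, PiLp.norm_sq_eq_of_L2] at hsq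
        simpa [opMatrix_apply] using hsq
  rw [mul_pow, PiLp.norm_sq_eq_of_L2, PiLp.norm_sq_eq_of_L2]
  exact le_of_tendsto' (tendsto_finsetSum _ fun i _ => (tendsto_norm_colMap h X hr (w i)).pow 2)
    fun i => hbound (r i)

theorem actRep_wstarContinuous : IsWStarContinuous (actRep h X) := by
  let j : B →ₗᵢ[ℂ] (K₀ →L[ℂ] K₀) := ⟨B.val.toLinearMap, fun _ => rfl⟩
  have hj : IsClosed[wstarTopology K₀ K₀] (j.toLinearMap.range : Set (K₀ →L[ℂ] K₀)) := by
    have hrange : (j.toLinearMap.range : Set (K₀ →L[ℂ] K₀)) = B := Subtype.range_coe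
    rw [hrange]
    exact h.isClosed_right
  have hdense := FUSpace.dense_span_range_tmul_toU h X
  refine continuous_wstar_of_dense hj (LinearMap.mkContinuous (E := B) (actRep h X).toLinearMap 1
    fun b => (norm_actCLM_le h X b).trans_eq (one_mul _).symm) hdense hdense ?_
  rintro _ ⟨⟨m, x⟩, rfl⟩ _ ⟨⟨n, y⟩, rfl⟩
  rw [mem_wstarDual]
  have hcoeff (b : B) : ⟪FUSpace.tmul h X (toU n) y, actCLM h X b (FUSpace.tmul h X (toU m) x)⟫_ℂ =
      ⟪y, X.rep (h.mulVU (adjV n) (mulU b (toU m))) x⟫_ℂ := by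
    rw [actCLM_tmul, inner_tmul_left, evalV_tmul]
  let : TopologicalSpace B := TopologicalSpace.induced Subtype.val (wstarTopology K₀ K₀)
  exact (continuous_inner_rep_mulVU h X (adjV n) (toU m) x y).congr fun b => (hcoeff b).symm

theorem IsTROEquivalence.wellDefined : FUWellDefined h where
  parallelogram X := FUSpace.innerProductSpaceable h X
  completelyContractive X := actRep_completelyContractive h X
  wstarContinuous X := actRep_wstarContinuous h X

end InnerProduct

/-! ### The `Δ`-extension -/

section DeltaExtension

open ContinuousLinearMap

variable {H₀ K₀ : Type u}
  [NormedAddCommGroup H₀] [InnerProductSpace ℂ H₀] [CompleteSpace H₀]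
  [NormedAddCommGroup K₀] [InnerProductSpace ℂ K₀] [CompleteSpace K₀]
  {A : Subalgebra ℂ (H₀ →L[ℂ] H₀)} {B : Subalgebra ℂ (K₀ →L[ℂ] K₀)}
  {M : Submodule ℂ (H₀ →L[ℂ] K₀)} (h : IsTROEquivalence A B M)

theorem IsTROEquivalence.mulVU_adjV_mulU_toU_mem_diagonal (m n : M) {b : B}
    (hb : (b : K₀ →L[ℂ] K₀) ∈ diagonal B) :
    (h.mulVU (adjV m) (mulU b (toU n)) : H₀ →L[ℂ] H₀) ∈ diagonal A := by
  refine ⟨(h.mulVU (adjV m) (mulU b (toU n))).2, ?_⟩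
  have hstar : star (h.mulVU (adjV m) (mulU b (toU n)) : H₀ →L[ℂ] H₀) =
      h.mulVU (adjV n) (mulU ⟨star (b : K₀ →L[ℂ] K₀), hb.2⟩ (toU m)) := by
    change ((m : H₀ →L[ℂ] K₀).adjoint ∘L (b : K₀ →L[ℂ] K₀) ∘L n).adjoint =
      (n : H₀ →L[ℂ] K₀).adjoint ∘L (b : K₀ →L[ℂ] K₀).adjoint ∘L m
    simp only [adjoint_comp, adjoint_adjoint, comp_assoc]
  rw [hstar]
  exact (h.mulVU _ _).2

theorem NormalRep.DHom.apply_rep_mulVU {X Y : NormalRep A} (f : NormalRep.DHom X Y) (m n : M)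
    {b : B} (hb : (b : K₀ →L[ℂ] K₀) ∈ diagonal B) (x : X.carrier) :
    f.toCLM (X.rep (h.mulVU (adjV m) (mulU b (toU n))) x) =
      Y.rep (h.mulVU (adjV m) (mulU b (toU n))) (f.toCLM x) :=
  DFunLike.congr_fun (f.comm _ (h.mulVU_adjV_mulU_toU_mem_diagonal m n hb)) x

theorem one_mem_diagonal (B : Subalgebra ℂ (K₀ →L[ℂ] K₀)) : (1 : K₀ →L[ℂ] K₀) ∈ diagonal B :=
  ⟨B.one_mem, by rw [star_one]; exact B.one_mem⟩

variable {X Y : NormalRep A}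

/-- The formal linear combination `∑ c (m, x)` sent to `∑ c m ⊗ g(x)` in `F_U(H)`, for a set
`S` of labels of vectors of `H` and `m ∈ M`. -/
def tmulCombination (Y : NormalRep A) {S : Type*} (g : S → Y.carrier) :
    (M × S →₀ ℂ) →ₗ[ℂ] FUSpace h Y :=
  Finsupp.linearCombination ℂ fun p => FUSpace.tmul h Y (toU p.1) (g p.2)

theorem tmulCombination_single {S : Type*} (g : S → Y.carrier) (m : M) (x : S) :
    tmulCombination h Y g (.single (m, x) 1) = FUSpace.tmul h Y (toU m) (g x) := by
  rw [tmulCombination, Finsupp.linearCombination_single, one_smul]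

theorem denseRange_tmulCombination_id (X : NormalRep A) :
    DenseRange (tmulCombination (M := M) h X id) := by
  rw [DenseRange, ← LinearMap.coe_range, tmulCombination, Finsupp.range_linearCombination]
  exact FUSpace.dense_span_range_tmul_toU h X

variable (f : NormalRep.DHom X Y)

theorem evalV_tmulCombination (m : M) (z : M × X.carrier →₀ ℂ) :
    evalV h Y (adjV m) (tmulCombination h Y f.toCLM z) =
      f.toCLM (evalV h X (adjV m) (tmulCombination h X id z)) := by
  simp only [tmulCombination, Finsupp.linearCombination_apply, Finsupp.sum, map_sum, map_smul]
  refine Finset.sum_congr rfl fun p _ => congrArg (z p • ·) ?_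
  rw [evalV_tmul, evalV_tmul]
  exact (f.apply_rep_mulVU h m p.1 (b := 1) (one_mem_diagonal B) p.2).symm

theorem norm_tmulCombination_le (z : M × X.carrier →₀ ℂ) :
    ‖tmulCombination h Y f.toCLM z‖ ≤ ‖f.toCLM‖ * ‖tmulCombination h X id z‖ := by
  obtain ⟨r, hr⟩ := exists_isApproxUnit h.isTRO
  refine le_of_tendsto' (tendsto_norm_colMap h Y hr _) fun i => ?_
  refine le_trans (le_of_sq_le_sq ?_ (by positivity))
    (mul_le_mul_of_nonneg_left (norm_colMap_le h X (r i) _) (norm_nonneg _))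
  rw [mul_pow, norm_colMap_sq, norm_colMap_sq, Finset.mul_sum]
  gcongr with k
  rw [evalV_tmulCombination, ← mul_pow]
  exact pow_le_pow_left₀ (norm_nonneg _) (f.toCLM.le_opNorm _) 2

/-- The value of the `Δ`-extension of `F_U` at a `Δ(A)`-module map `f`: the operator
`m ⊗ x ↦ m ⊗ f(x)`, for `m ∈ M`. -/
def deltaMap : FUSpace h X →L[ℂ] FUSpace h Y :=
  (tmulCombination h Y f.toCLM).extendOfNorm (tmulCombination h X id)

theorem deltaMap_tmul (m : M) (x : X.carrier) :
    deltaMap h f (FUSpace.tmul h X (toU m) x) = FUSpace.tmul h Y (toU m) (f.toCLM x) := by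
  have heq := LinearMap.extendOfNorm_eq (denseRange_tmulCombination_id h X)
    ⟨‖f.toCLM‖, norm_tmulCombination_le h f⟩ (.single (m, x) 1)
  rwa [tmulCombination_single, tmulCombination_single] at heq

theorem evalV_mulV_deltaMap (m : M) {b : B} (hb : (b : K₀ →L[ℂ] K₀) ∈ diagonal B)
    (z : FUSpace h X) : evalV h Y (mulV (adjV m) b) (deltaMap h f z) =
      f.toCLM (evalV h X (mulV (adjV m) b) z) := by
  have heq : evalV h Y (mulV (adjV m) b) ∘L deltaMap h f =
      f.toCLM ∘L evalV h X (mulV (adjV m) b) :=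
    FUSpace.hom_ext_toU h X fun n x => by
      rw [comp_apply, comp_apply, deltaMap_tmul, evalV_tmul, evalV_tmul]
      exact (f.apply_rep_mulVU h m n hb x).symm
  exact DFunLike.congr_fun heq z

theorem evalV_deltaMap (m : M) (z : FUSpace h X) :
    evalV h Y (adjV m) (deltaMap h f z) = f.toCLM (evalV h X (adjV m) z) :=
  evalV_mulV_deltaMap h f m (b := 1) (one_mem_diagonal B) z

theorem deltaMap_adjoint : deltaMap h f.adjoint = (deltaMap h f).adjoint :=
  FUSpace.hom_ext_toU h Y fun m y => ext_inner_right ℂ fun z => by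
    rw [deltaMap_tmul, inner_tmul_left, adjoint_inner_left, inner_tmul_left, evalV_deltaMap]
    exact adjoint_inner_left f.toCLM _ _

theorem deltaMap_actCLM {b : B} (hb : (b : K₀ →L[ℂ] K₀) ∈ diagonal B) :
    deltaMap h f ∘L actCLM h X b = actCLM h Y b ∘L deltaMap h f :=
  ContinuousLinearMap.ext fun z => FUSpace.ext_evalV h Y fun m => by
    rw [comp_apply, comp_apply, evalV_deltaMap, evalV_actCLM, evalV_actCLM,
      evalV_mulV_deltaMap h f m hb]

/-- The `Δ`-extension of `F_U`. -/
def deltaFunctor : CategoryTheory.Functor (DNormalRep A) (DNormalRep B) where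
  obj X := ⟨FUObj h.wellDefined X.obj⟩
  map f := ⟨deltaMap h f, fun _ hb => deltaMap_actCLM h f hb⟩
  map_id X := NormalRep.DHom.ext (FUSpace.hom_ext_toU h X.obj fun m x => deltaMap_tmul h _ m x)
  map_comp {X Y Z} f g := NormalRep.DHom.ext (FUSpace.hom_ext_toU h X.obj fun m x => by
    change deltaMap h _ _ = deltaMap h g (deltaMap h f _)
    rw [deltaMap_tmul, deltaMap_tmul, deltaMap_tmul]
    rfl)

theorem deltaFunctor_isDeltaExtension : IsDeltaExtension (FU h.wellDefined) (deltaFunctor h) :=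
  CategoryTheory.Functor.hext (fun _ => rfl) fun X _ f => heq_of_eq <|
    NormalRep.DHom.ext <| FUSpace.hom_ext_toU h X fun m x =>
      (deltaMap_tmul h _ m x).trans (mapCLM_tmul h f _ x).symm

theorem deltaFunctor_isStarFunctor : IsStarFunctor (deltaFunctor h) :=
  fun _ _ f => NormalRep.DHom.ext (deltaMap_adjoint h f)

theorem mapCLM_deltaFunctor (hG : IsDeltaExtension (FU h.wellDefined) (deltaFunctor h))
    {X Y : DNormalRep A} (f : X ⟶ Y) : hG.mapCLM f = deltaMap h f :=
  rfl

end DeltaExtension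

end DualOpAlg

end

open CategoryTheory DualOpAlg in
theorem theorem4p3 {H₀ K₀ : Type u}
    [NormedAddCommGroup H₀] [InnerProductSpace ℂ H₀] [CompleteSpace H₀]
    [NormedAddCommGroup K₀] [InnerProductSpace ℂ K₀] [CompleteSpace K₀]
    (A : Subalgebra ℂ (H₀ →L[ℂ] H₀)) (B : Subalgebra ℂ (K₀ →L[ℂ] K₀))
    (M : Submodule ℂ (H₀ →L[ℂ] K₀)) (h : IsTROEquivalence A B M) :
    ∃ (w : FUWellDefined h) (G : DNormalRep A ⥤ DNormalRep B)
      (hG : IsDeltaExtension (FU w) G),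
      (∀ (X Y : DNormalRep A) (f : X ⟶ Y) (m : H₀ →L[ℂ] K₀) (hm : m ∈ M) (x : X.obj.carrier),
        hG.mapCLM f (FUSpace.tmul h X.obj ⟨m, mem_bimodU hm⟩ x) =
          FUSpace.tmul h Y.obj ⟨m, mem_bimodU hm⟩ (NormalRep.DHom.toCLM f x)) ∧
      IsStarFunctor G := by
  refine ⟨h.wellDefined, deltaFunctor h, deltaFunctor_isDeltaExtension h,
    fun X Y f m hm x => ?_, deltaFunctor_isStarFunctor h⟩
  rw [mapCLM_deltaFunctor]
  exact deltaMap_tmul h f ⟨m, hm⟩ x
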